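/- Let $r,s\ge 3$ be integers such that $\log_r(s)$ is irrational, and let $K\subseteq\{1,\dots,r-2\}$ and $L\subseteq\{1,\dots,s-2\}$ be nonempty. Let $C_{r,K}$ be the set of all numbers in $[0,1]$ that admit a base $r$ expansion $0.a_1a_2a_3\dots=\sum_{i\ge1}a_ir^{-i}$, with $a_i\in\{0,\dots,r-1\}$, in which no digit $a_i$ belongs to $K$, and define $C_{s,L}$ in the same way. Consider the first-order structure $\mathcal R=(\mathbb R,<,+,C_{r,K},C_{s,L})$, in which $<$ and $+$ are the usual order and addition of real numbers and the two Cantor sets are named by unary predicates. Then: (1) for every $n\in\mathbb N$, every compact subset of $\mathbb R^n$ is definable in $\mathcal R$ by a first-order formula, possibly with real parameters; (2) the theory of $\mathcal R$ is undecidable: no algorithm decides, given (the Gödel number of) a parameter-free first-order sentence in the language of $\mathcal R$, whether that sentence is true in $\mathcal R$. -/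

import Mathlib

open FirstOrder

/-- The set of all numbers in `[0,1]` that have a base `r` expansion `0.a₁a₂a₃…`
(with digits `aᵢ ∈ {0,…,r-1}`) in which no digit belongs to `K`. -/
def genCantorSet (r : ℕ) (K : Set ℕ) : Set ℝ :=
  {x | x ∈ Set.Icc (0 : ℝ) 1 ∧ ∃ a : ℕ → Fin r, (∀ i, (a i : ℕ) ∉ K) ∧ Real.ofDigits a = x}

/-- The only function symbol: a binary symbol for addition. -/
inductive CantorFunc : ℕ → Type
  | add : CantorFunc 2

/-- The relation symbols: a binary symbol for the strict order and two unary predicates. -/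
inductive CantorRel : ℕ → Type
  | lt : CantorRel 2
  | fst : CantorRel 1
  | snd : CantorRel 1

/-- The language `{<, +, P, Q}` with two unary predicate symbols `P`, `Q`. -/
def cantorLanguage : FirstOrder.Language.{0, 0} := ⟨CantorFunc, CantorRel⟩

/-- The structure `(ℝ, <, +, P, Q)` for two sets `P`, `Q` of real numbers. -/
@[reducible] def realExpansion (P Q : Set ℝ) : cantorLanguage.Structure ℝ where
  funMap {_} f := match f with
    | CantorFunc.add => fun v => v 0 + v 1
  RelMap {_} R := match R with
    | CantorRel.lt => fun v => v 0 < v 1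
    | CantorRel.fst => fun v => v 0 ∈ P
    | CantorRel.snd => fun v => v 0 ∈ Q

/-- The structure `S` on `ℝ` defines (with arbitrary real parameters) every compact subset of
every `ℝⁿ`. -/
def DefinesEveryCompactSet {L : FirstOrder.Language.{0, 0}} (S : L.Structure ℝ) : Prop :=
  letI := S
  ∀ (n : ℕ) (X : Set (Fin n → ℝ)), IsCompact X → (Set.univ : Set ℝ).Definable L X

/-- Gödel number of a term in the variables `x₀, …, xₙ₋₁`. -/
def termCode {n : ℕ} : cantorLanguage.Term (Empty ⊕ Fin n) → ℕ
  | .var (Sum.inl e) => e.elim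
  | .var (Sum.inr i) => Nat.pair 0 i
  | .func CantorFunc.add ts => Nat.pair 1 (Nat.pair (termCode (ts 0)) (termCode (ts 1)))

/-- Gödel number of a formula in the free variables `x₀, …, xₙ₋₁`. -/
def formulaCode : {n : ℕ} → cantorLanguage.BoundedFormula Empty n → ℕ
  | _, .falsum => Nat.pair 0 0
  | _, .equal t₁ t₂ => Nat.pair 1 (Nat.pair (termCode t₁) (termCode t₂))
  | _, .rel CantorRel.lt ts => Nat.pair 2 (Nat.pair (termCode (ts 0)) (termCode (ts 1)))
  | _, .rel CantorRel.fst ts => Nat.pair 3 (termCode (ts 0))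
  | _, .rel CantorRel.snd ts => Nat.pair 4 (termCode (ts 0))
  | _, .imp φ ψ => Nat.pair 5 (Nat.pair (formulaCode φ) (formulaCode ψ))
  | _, .all φ => Nat.pair 6 (formulaCode φ)

/-- Distinct terms have distinct Gödel numbers. -/
theorem termCode_injective {n : ℕ} :
    Function.Injective (termCode : cantorLanguage.Term (Empty ⊕ Fin n) → ℕ) := by
  intro t
  induction t with
  | var i =>
    intro u h
    rcases i with e | i
    · exact e.elim
    · rcases u with (e | j) | ⟨f, ts⟩
      · exact e.elim
      · simp only [termCode, Nat.pair_eq_pair] at h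
        rw [Fin.ext h.2]
      · cases f
        simp [termCode, Nat.pair_eq_pair] at h
  | func f ts ih =>
    intro u h
    cases f
    rcases u with (e | j) | ⟨f, us⟩
    · exact e.elim
    · simp [termCode, Nat.pair_eq_pair] at h
    · cases f
      simp only [termCode, Nat.pair_eq_pair] at h
      congr 1
      funext i
      fin_cases i
      · exact ih 0 h.2.1
      · exact ih 1 h.2.2

/-- Distinct formulas have distinct Gödel numbers. -/
theorem formulaCode_injective {n : ℕ} :
    Function.Injective (formulaCode : cantorLanguage.BoundedFormula Empty n → ℕ) := by
  intro φ
  induction φ with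
  | falsum =>
    rintro (_ | _ | ⟨R, us⟩ | _ | _) h <;> try cases R
    all_goals simp [formulaCode, Nat.pair_eq_pair] at h ⊢
  | equal t₁ t₂ =>
    rintro (_ | _ | ⟨R, us⟩ | _ | _) h <;> try cases R
    all_goals simp [formulaCode, Nat.pair_eq_pair] at h ⊢
    exact ⟨termCode_injective h.1, termCode_injective h.2⟩
  | rel R ts =>
    cases R <;> rintro (_ | _ | ⟨R, us⟩ | _ | _) h <;> try cases R
    all_goals simp [formulaCode, Nat.pair_eq_pair] at h ⊢
    all_goals
      congr 1
      funext i
      fin_cases i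
    · exact termCode_injective h.1
    · exact termCode_injective h.2
    · exact termCode_injective h
    · exact termCode_injective h
  | imp φ ψ ihφ ihψ =>
    rintro (_ | _ | ⟨R, us⟩ | _ | _) h <;> try cases R
    all_goals simp [formulaCode, Nat.pair_eq_pair] at h ⊢
    exact ⟨ihφ h.1, ihψ h.2⟩
  | all φ ih =>
    rintro (_ | _ | ⟨R, us⟩ | _ | _) h <;> try cases R
    all_goals simp [formulaCode, Nat.pair_eq_pair] at h ⊢
    exact ih h

/-- The theory of the structure `S` is decidable: some algorithm decides, given the Gödel number
of a sentence (without parameters), whether the sentence is true in `S`. -/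
def HasDecidableTheory (S : cantorLanguage.Structure ℝ) : Prop :=
  letI := S
  ∃ f : ℕ → Bool, Computable f ∧
    ∀ φ : cantorLanguage.Sentence, f (formulaCode φ) = true ↔ φ ∈ cantorLanguage.completeTheory ℝ

/-! A gap of a Cantor set records its scale: the right endpoint of a gap of length at least r^(-n)
lies in r^(-n)ℤ (`IsGap.right_eq_natCast_div`). The gaps whose right endpoints are truncations of
one fixed periodic real single out the scales r^(-2i), and sums of boundedly many right endpoints
fill out the grids, so the grids in base r^2 are definable (`FirstRun.hasBase_sq`). A base b grid
gives access to base b digits. With n represented by b^(-n), every subset of ℕ is then coded by a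
real, and quantification over subsets of ℕ becomes available.

The second base gives more. The least positive difference between the grids of steps R^(-n) and
b^(-m) is 1/lcm(R^n, b^m). When R^n is close to b^m, the logarithm of this lcm grows like κ m log b,
and irrationality forces κ > 1 (`exists_log_lcm_growth`). Hence some F with F(m) close to κ m is
definable on exponents. Every block of a fixed length contains a point outside the range of F, and
the forward orbit of such a point is infinite. Sending each orbit to the block of its root is a
definable partial map on ℕ with infinite fibres. Such a map lets two subsets of ℕ code an arbitrary
binary relation (`exists_marker_sets`), so all of them are definable (`exists_base_dfnRel`). Through
digits, every bounded sequence of reals is then definable, and a compact set is a cube minus the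
balls listed by such a sequence.

For undecidability, compactness makes every relation on the codes 2^(-n) definable with parameters.
Quantifying over all parameters that satisfy suitable axioms, such as recursion equations, removes
them (`dfn_isInvPow_two`, `NatDfn.prec`). Graphs of partial recursive functions are thus definable
without parameters, and the halting problem reduces to the theory. -/

/-- A finite-dimensional coordinate space over `ℝ`, used as a context of real variables. -/
class RealCtx (Γ : Type) where
  ι : Type
  fin : Finite ι
  e : Γ ≃ (ι → ℝ)

attribute [instance] RealCtx.fin

instance : RealCtx ℝ := ⟨Unit, inferInstance, (Equiv.funUnique Unit ℝ).symm⟩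

instance (ι : Type) [Finite ι] : RealCtx (ι → ℝ) := ⟨ι, inferInstance, Equiv.refl _⟩

instance (Γ Δ : Type) [RealCtx Γ] [RealCtx Δ] : RealCtx (Γ × Δ) :=
  ⟨RealCtx.ι Γ ⊕ RealCtx.ι Δ, inferInstance,
    (Equiv.prodCongr RealCtx.e RealCtx.e).trans (Equiv.sumArrowEquivProdArrow _ _ _).symm⟩

/-! ### Calculus of definable predicates and maps -/

section Framework

variable (L : FirstOrder.Language.{0, 0}) [L.Structure ℝ] (A : Set ℝ)

/-- The predicate `P` is definable in the `L`-structure `ℝ` with parameters from `A`. -/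
def Dfn {Γ : Type} [RealCtx Γ] (P : Γ → Prop) : Prop :=
  A.Definable L {v : RealCtx.ι Γ → ℝ | P (RealCtx.e.symm v)}

/-- The map `f` has a definable graph. -/
@[fun_prop]
def DFun {Γ Δ : Type} [RealCtx Γ] [RealCtx Δ] (f : Γ → Δ) : Prop :=
  Dfn L A (fun q : Γ × Δ => q.2 = f q.1)

/-- Order and addition of the reals are definable without parameters. -/
class OrderAddDefinable : Prop where
  lt : Dfn L ∅ (fun v : Fin 2 → ℝ => v 0 < v 1)
  add : Dfn L ∅ (fun v : Fin 3 → ℝ => v 0 = v 1 + v 2)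

variable {L A}
variable {Γ Δ Θ : Type} [RealCtx Γ] [RealCtx Δ] [RealCtx Θ]

theorem Dfn.mono {B : Set ℝ} {P : Γ → Prop} (h : Dfn L A P) (hAB : A ⊆ B) : Dfn L B P :=
  Set.Definable.mono h hAB

theorem Dfn.and {P Q : Γ → Prop} (hP : Dfn L A P) (hQ : Dfn L A Q) :
    Dfn L A (fun p => P p ∧ Q p) := Set.Definable.inter hP hQ

theorem Dfn.or {P Q : Γ → Prop} (hP : Dfn L A P) (hQ : Dfn L A Q) :
    Dfn L A (fun p => P p ∨ Q p) := Set.Definable.union hP hQ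

theorem Dfn.not {P : Γ → Prop} (hP : Dfn L A P) : Dfn L A (fun p => ¬ P p) :=
  Set.Definable.compl hP

theorem Dfn.of_iff {P Q : Γ → Prop} (hP : Dfn L A P) (h : ∀ p, Q p ↔ P p) : Dfn L A Q := by
  rwa [show Q = P from funext fun p => propext (h p)]

theorem Dfn.imp {P Q : Γ → Prop} (hP : Dfn L A P) (hQ : Dfn L A Q) :
    Dfn L A (fun p => P p → Q p) :=
  (hP.not.or hQ).of_iff fun _ => imp_iff_not_or

theorem Dfn.iff {P Q : Γ → Prop} (hP : Dfn L A P) (hQ : Dfn L A Q) :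
    Dfn L A (fun p => P p ↔ Q p) :=
  ((hP.imp hQ).and (hQ.imp hP)).of_iff fun _ => iff_def

theorem Dfn.forall_finite {ι : Type} [Finite ι] {P : ι → Γ → Prop} (h : ∀ i, Dfn L A (P i)) :
    Dfn L A (fun p => ∀ i, P i p) := by
  have := Set.definable_iInter_of_finite h
  unfold Dfn
  convert this
  ext v
  simp

theorem Dfn.exists_finite {ι : Type} [Finite ι] {P : ι → Γ → Prop} (h : ∀ i, Dfn L A (P i)) :
    Dfn L A (fun p => ∃ i, P i p) := by
  have := Set.definable_iUnion_of_finite h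
  unfold Dfn
  convert this
  ext v
  simp

theorem Dfn.ex {P : Γ → Δ → Prop} (h : Dfn L A (fun q : Γ × Δ => P q.1 q.2)) :
    Dfn L A (fun p => ∃ x, P p x) := by
  have := Set.Definable.exists_of_finite h
  unfold Dfn
  convert this with v
  constructor
  · rintro ⟨x, hx⟩
    refine ⟨RealCtx.e x, ?_⟩
    change P (RealCtx.e.symm v) (RealCtx.e.symm (RealCtx.e x))
    rwa [Equiv.symm_apply_apply]
  · rintro ⟨u, hu⟩
    exact ⟨RealCtx.e.symm u, hu⟩

theorem Dfn.all {P : Γ → Δ → Prop} (h : Dfn L A (fun q : Γ × Δ => P q.1 q.2)) :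
    Dfn L A (fun p => ∀ x, P p x) :=
  (h.not.ex (P := fun p x => ¬ P p x)).not.of_iff fun _ => by simp

/-- Definability is stable under permuting, repeating and dropping variables. -/
theorem Dfn.reindex {P : Δ → Prop} (h : Dfn L A P) {f : Γ → Δ} (σ : RealCtx.ι Δ → RealCtx.ι Γ)
    (hσ : ∀ p, RealCtx.e (f p) = RealCtx.e p ∘ σ) : Dfn L A (fun p => P (f p)) := by
  have := Set.Definable.preimage_comp σ h
  unfold Dfn
  convert this
  ext v
  have h2 : f (RealCtx.e.symm v) = RealCtx.e.symm (v ∘ σ) := by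
    rw [Equiv.eq_symm_apply, hσ, Equiv.apply_symm_apply]
  simp [h2]

theorem Dfn.fst {P : Γ → Prop} (h : Dfn L A P) : Dfn L A (fun q : Γ × Δ => P q.1) :=
  h.reindex Sum.inl fun _ => rfl

theorem Dfn.snd {P : Δ → Prop} (h : Dfn L A P) : Dfn L A (fun q : Γ × Δ => P q.2) :=
  h.reindex Sum.inr fun _ => rfl

theorem Dfn.coord_eq (i j : RealCtx.ι Γ) :
    Dfn L A (fun p : Γ => RealCtx.e p i = RealCtx.e p j) := by
  refine ⟨(Language.Term.var i).equal (Language.Term.var j), ?_⟩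
  ext v
  simp

theorem DFun.of_reindex {f : Γ → Δ} (σ : RealCtx.ι Δ → RealCtx.ι Γ)
    (hσ : ∀ p, RealCtx.e (f p) = RealCtx.e p ∘ σ) : DFun L A f := by
  refine (Dfn.forall_finite (ι := RealCtx.ι Δ)
    (P := fun i (q : Γ × Δ) => RealCtx.e q (Sum.inr i) = RealCtx.e q (Sum.inl (σ i)))
    fun i => Dfn.coord_eq _ _).of_iff fun q => ?_
  rw [← RealCtx.e.injective.eq_iff, hσ, funext_iff]
  rfl

@[fun_prop]
theorem DFun.id : DFun L A (fun p : Γ => p) := .of_reindex (fun i => i) fun _ => rfl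

theorem Dfn.comp {P : Δ → Prop} (h : Dfn L A P) {f : Γ → Δ} (hf : DFun L A f) :
    Dfn L A (fun p => P (f p)) :=
  (Dfn.ex (P := fun p y => y = f p ∧ P y) (Dfn.and hf h.snd)).of_iff fun p => by simp

@[fun_prop]
theorem DFun.fst' : DFun L A (fun p : Γ × Δ => p.1) := .of_reindex Sum.inl fun _ => rfl

@[fun_prop]
theorem DFun.snd' : DFun L A (fun p : Γ × Δ => p.2) := .of_reindex Sum.inr fun _ => rfl

@[fun_prop]
theorem DFun.comp {g : Δ → Θ} {f : Γ → Δ} (hg : DFun L A g) (hf : DFun L A f) :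
    DFun L A (fun p => g (f p)) := by
  have h1 : Dfn L A (fun q : (Γ × Θ) × Δ => q.2 = f q.1.1) :=
    Dfn.reindex (f := fun q : (Γ × Θ) × Δ => (q.1.1, q.2)) hf
      (Sum.elim (Sum.inl ∘ Sum.inl) Sum.inr) fun p => by
        funext i; rcases i with i | i <;> rfl
  have h2 : Dfn L A (fun q : (Γ × Θ) × Δ => q.1.2 = g q.2) :=
    Dfn.reindex (f := fun q : (Γ × Θ) × Δ => (q.2, q.1.2)) hg
      (Sum.elim Sum.inr (Sum.inl ∘ Sum.inr)) fun p => by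
        funext i; rcases i with i | i <;> rfl
  exact (Dfn.ex (P := fun (p : Γ × Θ) y => y = f p.1 ∧ p.2 = g y) (h1.and h2)).of_iff
    fun p => by simp

@[fun_prop]
theorem DFun.fst {f : Γ → Δ × Θ} (hf : DFun L A f) : DFun L A (fun p => (f p).1) :=
  DFun.comp DFun.fst' hf

@[fun_prop]
theorem DFun.snd {f : Γ → Δ × Θ} (hf : DFun L A f) : DFun L A (fun p => (f p).2) :=
  DFun.comp DFun.snd' hf

@[fun_prop]
theorem DFun.prodMk {f : Γ → Δ} {g : Γ → Θ} (hf : DFun L A f) (hg : DFun L A g) :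
    DFun L A (fun p => (f p, g p)) := by
  have h1 : Dfn L A (fun q : Γ × (Δ × Θ) => q.2.1 = f q.1) :=
    Dfn.reindex (f := fun q : Γ × (Δ × Θ) => (q.1, q.2.1)) hf
      (Sum.elim Sum.inl (Sum.inr ∘ Sum.inl)) fun p => by
        funext i; rcases i with i | i <;> rfl
  have h2 : Dfn L A (fun q : Γ × (Δ × Θ) => q.2.2 = g q.1) :=
    Dfn.reindex (f := fun q : Γ × (Δ × Θ) => (q.1, q.2.2)) hg
      (Sum.elim Sum.inl (Sum.inr ∘ Sum.inr)) fun p => by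
        funext i; rcases i with i | i <;> rfl
  exact (h1.and h2).of_iff fun q => Prod.ext_iff

@[fun_prop]
theorem DFun.apply {ι : Type} [Finite ι] (i : ι) : DFun L A (fun p : ι → ℝ => p i) :=
  .of_reindex (fun _ => i) fun _ => rfl

@[fun_prop]
theorem DFun.pi {ι : Type} [Finite ι] {f : Γ → ι → ℝ} (hf : ∀ i, DFun L A (fun p => f p i)) :
    DFun L A f := by
  have h1 : ∀ i, Dfn L A (fun q : Γ × (ι → ℝ) => q.2 i = f q.1 i) := fun i =>
    Dfn.reindex (f := fun q : Γ × (ι → ℝ) => (q.1, q.2 i)) (hf i)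
      (Sum.elim Sum.inl (fun _ => Sum.inr i)) fun p => by
        funext i; rcases i with i | i <;> rfl
  exact (Dfn.forall_finite h1).of_iff fun q => funext_iff

theorem Dfn.eq {f g : Γ → Δ} (hf : DFun L A f) (hg : DFun L A g) :
    Dfn L A (fun p => f p = g p) :=
  Dfn.comp (P := fun q : Γ × Δ => q.2 = f q.1) hf (f := fun p => (p, g p)) (by fun_prop)
    |>.of_iff fun _ => eq_comm

theorem Dfn.comp₂ {R : Δ → Θ → Prop} (h : Dfn L A (fun q : Δ × Θ => R q.1 q.2))
    {f : Γ → Δ} {g : Γ → Θ} (hf : DFun L A f) (hg : DFun L A g) :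
    Dfn L A (fun p => R (f p) (g p)) :=
  Dfn.comp h (f := fun p => (f p, g p)) (by fun_prop)

theorem Dfn.comp₃ {Ξ : Type} [RealCtx Ξ] {R : Δ → Θ → Ξ → Prop}
    (h : Dfn L A (fun q : Δ × Θ × Ξ => R q.1 q.2.1 q.2.2))
    {f : Γ → Δ} {g : Γ → Θ} {k : Γ → Ξ} (hf : DFun L A f) (hg : DFun L A g) (hk : DFun L A k) :
    Dfn L A (fun p => R (f p) (g p) (k p)) :=
  Dfn.comp h (f := fun p => (f p, g p, k p)) (by fun_prop)

theorem DFun.const_of_mem {a : ℝ} (ha : a ∈ A) : DFun L A (fun _ : Γ => a) := by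
  have : Dfn L A (fun y : ℝ => y = a) := by
    exact Set.Definable.preimage_comp (L := L) (fun _ : Fin 1 => ())
      (Set.Definable.singleton_of_mem (L := L) (A := A) ha)
  exact this.snd

@[fun_prop]
theorem DFun.const (p : Δ) : DFun L Set.univ (fun _ : Γ => p) := by
  have h : DFun L Set.univ (fun _ : Γ => RealCtx.e p) :=
    DFun.pi fun i => DFun.const_of_mem (Set.mem_univ _)
  have h2 : DFun L Set.univ (fun v : RealCtx.ι Δ → ℝ => (RealCtx.e.symm v : Δ)) :=
    .of_reindex (fun i => i) fun v => by simp; rfl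
  simpa using DFun.comp h2 h

/-- A set definable with parameters is a fibre of a set definable without parameters. -/
theorem Dfn.exists_param {P : Γ → Prop} (h : Dfn L Set.univ P) :
    ∃ (k : ℕ) (Q : Γ → (Fin k → ℝ) → Prop) (c : Fin k → ℝ),
      Dfn L ∅ (fun q : Γ × (Fin k → ℝ) => Q q.1 q.2) ∧ ∀ p, P p ↔ Q p c := by
  obtain ⟨A₀, -, h⟩ := Set.definable_iff_finitely_definable.1 h
  obtain ⟨φ, hφ⟩ := Set.definable_iff_exists_formula_sum.1 h
  let e := A₀.equivFin
  refine ⟨A₀.card, fun p c => φ.Realize (Sum.elim (fun a => c (e a)) (RealCtx.e p)),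
    fun i => (e.symm i : ℝ), ?_, fun p => ?_⟩
  · refine Set.empty_definable_iff.2 ⟨φ.relabel (Sum.elim (fun a => Sum.inr (e a)) Sum.inl), ?_⟩
    ext v
    simp only [Set.mem_ofPred_eq, Language.Formula.realize_relabel]
    refine iff_of_eq (congrArg _ ?_)
    funext i
    rcases i with i | i
    · rfl
    · exact congrFun (RealCtx.e.apply_symm_apply _) i
  · have := Set.ext_iff.1 hφ (RealCtx.e p)
    simp only [Set.mem_ofPred_eq, Equiv.symm_apply_apply] at this
    simp only [e, Equiv.symm_apply_apply]
    exact this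

variable [OrderAddDefinable L]

theorem Dfn.lt {f g : Γ → ℝ} (hf : DFun L A f) (hg : DFun L A g) :
    Dfn L A (fun p => f p < g p) := by
  refine Dfn.comp ((OrderAddDefinable.lt (L := L)).mono (Set.empty_subset A))
    (f := fun p => ![f p, g p]) (DFun.pi fun i => ?_)
  fin_cases i
  exacts [hf, hg]

theorem Dfn.le {f g : Γ → ℝ} (hf : DFun L A f) (hg : DFun L A g) :
    Dfn L A (fun p => f p ≤ g p) := (Dfn.lt hg hf).not.of_iff fun _ => by simp

@[fun_prop]
theorem DFun.add {f g : Γ → ℝ} (hf : DFun L A f) (hg : DFun L A g) :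
    DFun L A (fun p => f p + g p) := by
  refine Dfn.comp ((OrderAddDefinable.add (L := L)).mono (Set.empty_subset A))
    (f := fun q : Γ × ℝ => ![q.2, f q.1, g q.1]) (DFun.pi fun i => ?_)
  fin_cases i
  exacts [DFun.snd', hf.comp DFun.fst', hg.comp DFun.fst']

@[fun_prop]
theorem DFun.sub {f g : Γ → ℝ} (hf : DFun L A f) (hg : DFun L A g) :
    DFun L A (fun p => f p - g p) :=
  (Dfn.eq (A := A) (L := L) (f := fun q : Γ × ℝ => q.2 + g q.1) (g := fun q => f q.1)
    (by fun_prop) (by fun_prop)).of_iff fun q => eq_sub_iff_add_eq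

/-- Zero is the only solution of y + y = y, so no parameter is needed. -/
theorem DFun.zero : DFun L A (fun _ : Γ => (0 : ℝ)) :=
  (Dfn.eq (A := A) (L := L) (f := fun q : Γ × ℝ => q.2 + q.2) (g := fun q => q.2)
    (by fun_prop) (by fun_prop)).of_iff fun q => by simp

@[fun_prop]
theorem DFun.natMul {f : Γ → ℝ} (hf : DFun L A f) (n : ℕ) :
    DFun L A (fun p => (n : ℝ) * f p) := by
  induction n with
  | zero => simpa using DFun.zero
  | succ n ih => simpa [add_mul] using ih.add hf

theorem DFun.finset_sum {ι : Type} (s : Finset ι) {f : ι → Γ → ℝ} (hf : ∀ i, DFun L A (f i)) :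
    DFun L A (fun p => ∑ i ∈ s, f i p) := by
  classical
  induction s using Finset.induction_on with
  | empty => simpa using DFun.zero
  | insert i s hi ih => simpa [Finset.sum_insert hi] using (hf i).add ih

end Framework

/-! ### Digits and gaps of a generalized Cantor set -/

section CantorDigits

variable {r : ℕ} {K : Set ℕ}

theorem ofDigits_mem_genCantorSet {a : ℕ → Fin r} (ha : ∀ i, (a i : ℕ) ∉ K) :
    Real.ofDigits a ∈ genCantorSet r K :=
  ⟨⟨Real.ofDigits_nonneg a, Real.ofDigits_le_one a⟩, a, ha, rfl⟩

/-- Self-similarity: multiplying by r and removing the leading digit shifts the expansion. -/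
theorem mem_genCantorSet_iff_step {x : ℝ} :
    x ∈ genCantorSet r K ↔ ∃ d < r, d ∉ K ∧ (r : ℝ) * x - d ∈ genCantorSet r K := by
  have key : ∀ a : ℕ → Fin r,
      (r : ℝ) * Real.ofDigits a - (a 0 : ℕ) = Real.ofDigits fun i => a (i + 1) := fun a => by
    have hr : (r : ℝ) ≠ 0 := Nat.cast_ne_zero.2 (Fin.pos (a 0)).ne'
    rw [Real.ofDigits_eq_sum_add_ofDigits a 1]
    simp only [Finset.range_one, Real.ofDigitsTerm, Finset.sum_singleton, zero_add, pow_one]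
    field_simp
    ring
  constructor
  · rintro ⟨-, a, ha, rfl⟩
    refine ⟨a 0, (a 0).2, ha 0, ?_⟩
    rw [key]
    exact ofDigits_mem_genCantorSet fun i => ha (i + 1)
  · rintro ⟨d, hd, hdK, -, a, ha, hx⟩
    let a' : ℕ → Fin r := fun i => Nat.casesOn i ⟨d, hd⟩ a
    have h := key a'
    have hr : (r : ℝ) ≠ 0 := Nat.cast_ne_zero.2 (by lia)
    have : x = Real.ofDigits a' := by
      have : (r : ℝ) * Real.ofDigits a' - d = (r : ℝ) * x - d := by rw [← hx]; exact h
      exact mul_left_cancel₀ hr (by linarith)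
    rw [this]
    refine ofDigits_mem_genCantorSet fun i => ?_
    cases i with
    | zero => exact hdK
    | succ i => exact ha i

variable (r K) in
/-- `AllowedPrefix r K n W`: the number `W` has `n` base `r` digits (with leading zeros), none of
them in `K`. -/
inductive AllowedPrefix : ℕ → ℕ → Prop
  | nil : AllowedPrefix 0 0
  | snoc {n W d : ℕ} : AllowedPrefix n W → d < r → d ∉ K → AllowedPrefix (n + 1) (W * r + d)

theorem AllowedPrefix.mem {n W : ℕ} (h : AllowedPrefix r K n W) {x : ℝ}
    (hx : (r : ℝ) ^ n * x - W ∈ genCantorSet r K) : x ∈ genCantorSet r K := by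
  induction h with
  | nil => simpa using hx
  | @snoc n W d _ hd hdK ih =>
    refine ih (mem_genCantorSet_iff_step.2 ⟨d, hd, hdK, ?_⟩)
    convert! hx using 1
    push_cast
    ring

theorem exists_allowedPrefix {x : ℝ} (hx : x ∈ genCantorSet r K) (n : ℕ) :
    ∃ W, AllowedPrefix r K n W ∧ (r : ℝ) ^ n * x - W ∈ genCantorSet r K := by
  induction n with
  | zero => exact ⟨0, .nil, by simpa using hx⟩
  | succ n ih =>
    obtain ⟨W, hW, h⟩ := ih
    obtain ⟨d, hd, hdK, h⟩ := mem_genCantorSet_iff_step.1 h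
    refine ⟨W * r + d, hW.snoc hd hdK, ?_⟩
    convert! h using 1
    push_cast
    ring

theorem AllowedPrefix.div_mem {n W : ℕ} (h : AllowedPrefix r K n W) (hr : 0 < r) {t : ℝ}
    (ht : t ∈ genCantorSet r K) : (W + t) / (r : ℝ) ^ n ∈ genCantorSet r K := by
  refine h.mem ?_
  have : (r : ℝ) ≠ 0 := by positivity
  convert! ht using 1
  field_simp
  ring

/-- `(x, z)` is a bounded complementary interval of `X`. -/
def IsGap (X : Set ℝ) (x z : ℝ) : Prop := x ∈ X ∧ z ∈ X ∧ x < z ∧ ∀ y ∈ X, y ≤ x ∨ z ≤ y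

theorem IsGap.left_unique {X : Set ℝ} {x x' z : ℝ} (h : IsGap X x z) (h' : IsGap X x' z) :
    x = x' := by
  apply le_antisymm
  · exact (h'.2.2.2 x h.1).resolve_right (not_le.2 h.2.2.1)
  · exact (h.2.2.2 x' h'.1).resolve_right (not_le.2 h'.2.2.1)

/-- The omitted digits `K` leave the digits `0` and `r - 1`, and `[k, b)` is the first run of
omitted digits. -/
structure FirstRun (r : ℕ) (K : Set ℕ) (k b : ℕ) : Prop where
  three_le : 3 ≤ r
  pos : 1 ≤ k
  k_lt : k < b
  b_lt : b < r
  notMem_of_lt : ∀ j < k, j ∉ K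
  mem_of_le : ∀ j, k ≤ j → j < b → j ∈ K
  notMem : b ∉ K
  last : r - 1 ∉ K

theorem exists_firstRun (hr : 3 ≤ r) (hK : K.Nonempty) (hKr : K ⊆ Set.Icc 1 (r - 2)) :
    ∃ k b, FirstRun r K k b := by
  classical
  have hlast : r - 1 ∉ K := fun h => by have := (hKr h).2; lia
  let k := Nat.find hK
  have hk : k ∈ K := Nat.find_spec hK
  have hex : ∃ b, k < b ∧ b ∉ K := ⟨r - 1, by have := (hKr hk).2; lia, hlast⟩
  obtain ⟨h1, h2⟩ := Nat.find_spec hex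
  refine ⟨k, Nat.find hex, hr, (hKr hk).1, h1, ?_, fun j hj => Nat.find_min hK hj,
    fun j hj hjb => ?_, h2, hlast⟩
  · have : Nat.find hex ≤ r - 1 := Nat.find_min' hex ⟨by have := (hKr hk).2; lia, hlast⟩
    lia
  · by_contra hjK
    rcases hj.eq_or_lt with rfl | hj
    · exact hjK hk
    · exact Nat.find_min hex hjb ⟨hj, hjK⟩

namespace FirstRun

variable {k b : ℕ} (h : FirstRun r K k b)
include h

theorem pos' : (0 : ℝ) < r := by have := h.three_le; positivity

theorem zero_notMem : 0 ∉ K := h.notMem_of_lt 0 h.pos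

theorem zero_mem : (0 : ℝ) ∈ genCantorSet r K := by
  have h0 : 0 < r := by have := h.three_le; lia
  refine ⟨by simp, fun _ => ⟨0, h0⟩, fun _ => h.zero_notMem, ?_⟩
  simp [Real.ofDigits, Real.ofDigitsTerm]

theorem one_mem : (1 : ℝ) ∈ genCantorSet r K := by
  have h1 : 1 < r := by have := h.three_le; lia
  refine ⟨by simp, fun _ => ⟨r - 1, by lia⟩, fun _ => h.last, ?_⟩
  exact Real.ofDigits_const_last_eq_one' h1

/-- The expansion has j digits r - 1 followed by zeros. These points show that 1 is a limit of the
Cantor set from the left. -/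
theorem one_sub_inv_pow_mem (j : ℕ) : 1 - ((r : ℝ)⁻¹) ^ j ∈ genCantorSet r K := by
  induction j with
  | zero => simpa using h.zero_mem
  | succ j ih =>
    have := h.three_le
    refine mem_genCantorSet_iff_step.2 ⟨r - 1, by lia, h.last, ?_⟩
    have h0 := h.pos'
    convert! ih using 1
    have h1 : (r : ℝ) * (r : ℝ)⁻¹ = 1 := mul_inv_cancel₀ h0.ne'
    rw [Nat.cast_sub (by lia), pow_succ]
    push_cast
    linear_combination (-((r : ℝ)⁻¹) ^ j) * h1

theorem exists_mem_Ioo {t : ℝ} (ht : t < 1) : ∃ t' ∈ genCantorSet r K, t < t' ∧ t' < 1 := by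
  have h1 : ((r : ℝ)⁻¹) < 1 := by
    have := h.three_le
    exact inv_lt_one_of_one_lt₀ (by exact_mod_cast (by lia : 1 < r))
  obtain ⟨j, hj⟩ := exists_pow_lt_of_lt_one (sub_pos.2 ht) h1
  have h0 := h.pos'
  have : 0 < ((r : ℝ)⁻¹) ^ j := by positivity
  exact ⟨_, h.one_sub_inv_pow_mem j, by linarith, by linarith⟩

/-- The left end is W followed by k - 1 and then digits r - 1 forever; the right end is W followed
by b and then zeros. A point strictly between would need a digit from the omitted run after W. -/
theorem isGap {n W : ℕ} (hW : AllowedPrefix r K n W) :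
    IsGap (genCantorSet r K) (((W * r + k : ℕ) : ℝ) / (r : ℝ) ^ (n + 1))
      (((W * r + b : ℕ) : ℝ) / (r : ℝ) ^ (n + 1)) := by
  have h0 := h.pos'
  have hr := h.three_le
  have hk := h.pos
  have hkb := h.k_lt
  have hb := h.b_lt
  have hp : 0 < (r : ℝ) ^ (n + 1) := by positivity
  refine ⟨?_, ?_, ?_, fun y hy => ?_⟩
  · have := (hW.snoc (d := k - 1) (by lia) (h.notMem_of_lt _ (by lia))).div_mem (by lia) h.one_mem
    convert! this using 2
    have hkk : W * r + k = W * r + (k - 1) + 1 := by lia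
    rw [hkk, Nat.cast_add, Nat.cast_one]
  · have := (hW.snoc h.b_lt h.notMem).div_mem (by lia) h.zero_mem
    simpa using this
  · gcongr
  · obtain ⟨V, hV, hy'⟩ := exists_allowedPrefix hy (n + 1)
    obtain ⟨h1, h2⟩ := hy'.1
    by_contra! hcon
    obtain ⟨h3, h4⟩ := hcon
    rw [div_lt_iff₀ hp] at h3
    rw [lt_div_iff₀ hp] at h4
    have h5 : W * r + k < V + 1 := by
      have : ((W * r + k : ℕ) : ℝ) < (V + 1 : ℕ) := by push_cast at h3 ⊢; linarith
      exact_mod_cast this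
    have h6 : V < W * r + b := by
      have : (V : ℝ) < (W * r + b : ℕ) := by push_cast at h4 ⊢; linarith
      exact_mod_cast this
    cases hV with
    | @snoc _ W' d _ hd hdK =>
      have hWW : W' = W := by
        have h7 : (W' * r + d) / r = W' := by
          rw [add_comm, Nat.add_mul_div_right _ _ (by lia), Nat.div_eq_of_lt hd, zero_add]
        have h8 : (W' * r + d) / r = W := by
          apply Nat.div_eq_of_lt_le
          · lia
          · rw [Nat.succ_mul]; lia
        lia
      subst hWW
      exact hdK (h.mem_of_le d (by lia) (by lia))

end FirstRun

/-- The truncation of z to n digits lies in the set and is less than r^(-n) below z, unless the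
remaining tail equals 1. In the first case a gap of this length leaves no room for it below z, so it
is z itself; in the second z is the next grid point. -/
theorem IsGap.right_eq_natCast_div (hr : 0 < r) (h0 : (0 : ℝ) ∈ genCantorSet r K)
    {x z : ℝ} (hg : IsGap (genCantorSet r K) x z) {n : ℕ} (hl : 1 / (r : ℝ) ^ n ≤ z - x) :
    ∃ N : ℕ, z = N / (r : ℝ) ^ n := by
  obtain ⟨hx, hz, hxz, hxy⟩ := hg
  obtain ⟨W, hW, hzW⟩ := exists_allowedPrefix hz n
  have hp : 0 < (r : ℝ) ^ n := by positivity
  obtain ⟨h1, h2⟩ := hzW.1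
  by_cases hone : (r : ℝ) ^ n * z - W = 1
  · exact ⟨W + 1, by rw [eq_div_iff hp.ne']; push_cast; linarith⟩
  refine ⟨W, ?_⟩
  have hmem := hW.div_mem hr h0
  rw [add_zero] at hmem
  rcases hxy _ hmem with h3 | h3
  · have h4 : 1 ≤ (r : ℝ) ^ n * (z - x) := by
      rw [div_le_iff₀ hp] at hl
      linarith
    rw [div_le_iff₀ hp] at h3
    exact absurd (by linarith) (lt_of_le_of_ne h2 hone).not_ge
  · rw [le_div_iff₀ hp] at h3
    rw [eq_div_iff hp.ne']
    linarith

end CantorDigits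

/-! ### Recovering powers and grids from gaps -/

section CantorGrid

variable {r : ℕ} {K : Set ℕ}

/-- The number with base `r ^ 2` digits `b, b, …, b` (`i` of them). -/
def repdigit (r b : ℕ) : ℕ → ℕ
  | 0 => 0
  | i + 1 => (repdigit r b i * r + 0) * r + b

theorem repdigit_cast (hr : 2 ≤ r) (b i : ℕ) :
    (repdigit r b i : ℝ) =
      (r : ℝ) ^ (2 * i) * (b / ((r : ℝ) ^ 2 - 1)) - b / ((r : ℝ) ^ 2 - 1) := by
  have h2 : (2 : ℝ) ≤ r := by exact_mod_cast hr
  have h1 : (r : ℝ) ^ 2 - 1 ≠ 0 := by nlinarith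
  induction i with
  | zero => simp [repdigit]
  | succ i ih =>
    simp only [repdigit]
    push_cast
    rw [ih]
    field_simp
    ring

namespace FirstRun

variable {k b : ℕ} (h : FirstRun r K k b)
include h

theorem allowedPrefix_repdigit (i : ℕ) : AllowedPrefix r K (2 * i) (repdigit r b i) := by
  induction i with
  | zero => exact .nil
  | succ i ih =>
    exact (ih.snoc (by have := h.three_le; lia) h.zero_notMem).snoc h.b_lt h.notMem

/-- If the gap were shorter, its left end would lie in the level n cylinder ending at V / r^n. That
cylinder contains points of the set arbitrarily close to its right end, because the digit r - 1 is
allowed. -/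
theorem one_div_pow_le_gap {n V : ℕ} {x : ℝ}
    (hg : IsGap (genCantorSet r K) x (V / (r : ℝ) ^ n)) :
    1 / (r : ℝ) ^ n ≤ V / (r : ℝ) ^ n - x := by
  have h0 := h.pos'
  have hr := h.three_le
  have hp : 0 < (r : ℝ) ^ n := by positivity
  obtain ⟨hx, -, hxz, hxy⟩ := hg
  by_contra! hcon
  obtain ⟨W, hW, hxW⟩ := exists_allowedPrefix hx n
  rw [lt_div_iff₀ hp] at hxz
  have hcon : (V : ℝ) - 1 < x * (r : ℝ) ^ n := by
    rw [← div_lt_iff₀ hp, sub_div]; linarith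
  obtain ⟨h1, h2⟩ := hxW.1
  have h3 : W < V := by
    have : (W : ℝ) < V := by linarith
    exact_mod_cast this
  have h4 : V < W + 2 := by
    have : (V : ℝ) < (W + 2 : ℕ) := by push_cast; linarith
    exact_mod_cast this
  have h5 : (V : ℝ) = W + 1 := by exact_mod_cast (by lia : V = W + 1)
  obtain ⟨t, ht, htl, ht1⟩ := h.exists_mem_Ioo (t := (r : ℝ) ^ n * x - W) (by linarith)
  rcases hxy _ (hW.div_mem (by lia) ht) with h6 | h6
  · rw [div_le_iff₀ hp] at h6
    linarith
  · have := (div_le_div_iff_of_pos_right hp).1 h6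
    linarith

/-- The test point p = b / (r^2 - 1) has the expansion 0.0b0b0b…, and the condition reads z ≤ p < z
+ (z - x) / r. If n is least with r^(-n) ≤ z - x, then p - z < r^(-n), so z is the truncation of p
to n digits. For odd n the last digit is 0, and the gap would already have length at least
r^(-(n-1)). For even n the gap is the one found in `isGap`, of length (b - k) r^(-n). All of these
pass the test, since the zeros in p give r p < 1 ≤ b - k. -/
theorem exists_gap_iff (e : ℝ) :
    (∃ x z : ℝ, IsGap (genCantorSet r K) x z ∧ z - x = ((b - k : ℕ) : ℝ) * e ∧
      z ≤ b / ((r : ℝ) ^ 2 - 1) ∧ (r : ℝ) * (b / ((r : ℝ) ^ 2 - 1)) < r * z + (z - x)) ↔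
    ∃ i, e = 1 / (r : ℝ) ^ (2 * (i + 1)) := by
  have h0 := h.pos'
  have hr := h.three_le
  have hk := h.pos
  have hkb := h.k_lt
  have hb := h.b_lt
  have hr3 : (3 : ℝ) ≤ r := by exact_mod_cast hr
  have hbr : (b : ℝ) ≤ r - 1 := by
    have : ((b + 1 : ℕ) : ℝ) ≤ r := by exact_mod_cast hb
    push_cast at this; linarith
  have hm : (1 : ℝ) ≤ ((b - k : ℕ) : ℝ) := by exact_mod_cast (by lia : 1 ≤ b - k)
  have hmk : ((b - k : ℕ) : ℝ) = b - k := Nat.cast_sub hkb.le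
  have hden : 0 < (r : ℝ) ^ 2 - 1 := by nlinarith
  set p : ℝ := b / ((r : ℝ) ^ 2 - 1) with hp
  have hbp : 0 < (b : ℝ) := by exact_mod_cast (by lia : 0 < b)
  have hp0 : 0 < p := by positivity
  have hrp : (r : ℝ) * p < 1 := by
    rw [hp, mul_div_assoc', div_lt_one hden]
    nlinarith
  have hp1 : p < 1 := by nlinarith
  have hrep : ∀ i, (repdigit r b i : ℝ) = (r : ℝ) ^ (2 * i) * p - p := fun i =>
    repdigit_cast (by lia) b i
  clear_value p
  have hgap : ∀ i, IsGap (genCantorSet r K)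
      (((repdigit r b (i + 1) : ℕ) - (b - k : ℕ)) / (r : ℝ) ^ (2 * (i + 1)))
      ((repdigit r b (i + 1) : ℕ) / (r : ℝ) ^ (2 * (i + 1))) := fun i => by
    have := h.isGap ((h.allowedPrefix_repdigit i).snoc (by lia) h.zero_notMem)
    convert! this using 2
    rw [hmk, repdigit]
    push_cast
    ring
  constructor
  · rintro ⟨x, z, hg, hl, hz, hpz⟩
    have hxz := hg.2.2.1
    have hx0 : 0 ≤ x := hg.1.1.1
    have hex : ∃ n : ℕ, 1 / (r : ℝ) ^ n ≤ z - x := by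
      obtain ⟨n, hn⟩ := exists_pow_lt_of_lt_one (sub_pos.2 hxz)
        (inv_lt_one_of_one_lt₀ (by linarith : (1 : ℝ) < r))
      exact ⟨n, by rw [one_div, ← inv_pow]; exact hn.le⟩
    classical
    obtain ⟨n, hn, hmin⟩ : ∃ n, 1 / (r : ℝ) ^ n ≤ z - x ∧ ∀ j < n, z - x < 1 / (r : ℝ) ^ j :=
      ⟨Nat.find hex, Nat.find_spec hex, fun j hj => not_le.1 (Nat.find_min hex hj)⟩
    cases n with
    | zero =>
      simp only [pow_zero, div_one] at hn
      nlinarith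
    | succ n =>
      have hl' := hmin n (by lia)
      obtain ⟨N, rfl⟩ := hg.right_eq_natCast_div (by lia) h.zero_mem hn
      have hpn : 0 < (r : ℝ) ^ n := by positivity
      have hpn1 : 0 < (r : ℝ) ^ (n + 1) := by positivity
      have hfl : (N : ℝ) ≤ (r : ℝ) ^ (n + 1) * p := by
        rw [div_le_iff₀ hpn1] at hz; linarith
      have hfl' : (r : ℝ) ^ (n + 1) * p < N + 1 := by
        have h1 : (r : ℝ) * p < r * (N / (r : ℝ) ^ (n + 1)) + 1 / (r : ℝ) ^ n := by linarith
        have h2 : (r : ℝ) * (N / (r : ℝ) ^ (n + 1)) + 1 / (r : ℝ) ^ n = (N + 1) / (r : ℝ) ^ n := by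
          rw [pow_succ]; field_simp
        rw [h2, lt_div_iff₀ hpn] at h1
        rw [pow_succ]; linarith
      have huniq : ∀ M : ℕ, (M : ℝ) ≤ (r : ℝ) ^ (n + 1) * p → (r : ℝ) ^ (n + 1) * p < M + 1 →
          N = M := fun M h1 h2 => by
        have h3 : N < M + 1 := by
          have : (N : ℝ) < (M + 1 : ℕ) := by push_cast; linarith
          exact_mod_cast this
        have h4 : M < N + 1 := by
          have : (M : ℝ) < (N + 1 : ℕ) := by push_cast; linarith
          exact_mod_cast this
        lia
      -- The level is n + 1, so even n is the case where the truncation ends in the digit 0.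
      rcases Nat.even_or_odd' n with ⟨i, rfl | rfl⟩
      · have hN : N = repdigit r b i * r := by
          apply huniq
          · push_cast
            rw [hrep, pow_succ]
            nlinarith
          · push_cast
            rw [hrep, pow_succ]
            nlinarith
        have hz' : (N : ℝ) / (r : ℝ) ^ (2 * i + 1) = repdigit r b i / (r : ℝ) ^ (2 * i) := by
          rw [hN, pow_succ]
          push_cast
          field_simp
        rw [hz'] at hg hl'
        exact absurd hl' (h.one_div_pow_le_gap hg).not_gt
      · have hN : N = repdigit r b (i + 1) := by
          apply huniq
          · rw [hrep, show 2 * (i + 1) = 2 * i + 1 + 1 by ring]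
            linarith
          · rw [hrep, show 2 * (i + 1) = 2 * i + 1 + 1 by ring]
            linarith
        have hg2 := hgap i
        rw [← hN, show 2 * (i + 1) = 2 * i + 1 + 1 by ring] at hg2
        have hx := hg.left_unique hg2
        refine ⟨i, ?_⟩
        rw [hx, ← sub_div, sub_sub_cancel] at hl
        rw [show 2 * (i + 1) = 2 * i + 1 + 1 by ring]
        have hm0 : ((b - k : ℕ) : ℝ) ≠ 0 := by linarith
        apply mul_left_cancel₀ hm0
        rw [← hl]; ring
  · rintro ⟨i, rfl⟩
    have hpn : 0 < (r : ℝ) ^ (2 * (i + 1)) := by positivity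
    refine ⟨_, _, hgap i, by ring, ?_, ?_⟩
    · rw [div_le_iff₀ hpn, hrep]
      linarith
    · rw [← sub_div, sub_sub_cancel, mul_div_assoc', ← add_div, lt_div_iff₀ hpn, hrep]
      nlinarith

/-- A digit d is a sum of d ones, so r - 1 summands with digits 0 and 1 suffice. Multiplied by b,
each has only the digits 0 and b; if nonzero, its last b marks the right end of a gap. -/
theorem exists_digit_split (n : ℕ) : ∀ Y < r ^ n, ∃ f : Fin (r - 1) → ℕ, Y = ∑ i, f i ∧
    ∀ i, AllowedPrefix r K n (b * f i) ∧ (f i = 0 ∨ ∃ x, IsGap (genCantorSet r K) x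
      (((b * f i : ℕ) : ℝ) / (r : ℝ) ^ n) ∧
        1 / (r : ℝ) ^ n ≤ ((b * f i : ℕ) : ℝ) / (r : ℝ) ^ n - x) := by
  have h0 := h.pos'
  have hr := h.three_le
  have hkb := h.k_lt
  induction n with
  | zero =>
    intro Y hY
    exact ⟨fun _ => 0, by simp at hY; simp [hY], fun i => ⟨.nil, .inl rfl⟩⟩
  | succ n ih =>
    intro Y hY
    obtain ⟨f, hf, hfi⟩ := ih (Y / r) (Nat.div_lt_of_lt_mul (by rwa [mul_comm, ← pow_succ]))
    have hd : Y % r < r := Nat.mod_lt _ (by lia)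
    refine ⟨fun i => f i * r + if i.1 < Y % r then 1 else 0, ?_, fun i => ?_⟩
    · rw [Finset.sum_add_distrib, ← Finset.sum_mul, ← hf]
      have : ∑ i : Fin (r - 1), (if i.1 < Y % r then 1 else 0) = Y % r := by
        rw [Fin.sum_univ_eq_sum_range (fun i => if i < Y % r then 1 else 0) (r - 1)]
        rw [← Finset.sum_filter, Finset.sum_const, smul_eq_mul, mul_one]
        have : (Finset.range (r - 1)).filter (fun i => i < Y % r) = Finset.range (Y % r) := by
          ext i; simp; lia
        rw [this, Finset.card_range]
      rw [this]
      exact (Nat.div_add_mod' Y r).symm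
    · obtain ⟨hA, hB⟩ := hfi i
      dsimp only
      split_ifs with hi
      · have h1 : b * (f i * r + 1) = b * f i * r + b := by ring
        rw [h1]
        refine ⟨hA.snoc h.b_lt h.notMem, .inr ⟨_, h.isGap hA, ?_⟩⟩
        rw [← sub_div]
        gcongr
        push_cast
        have : ((k + 1 : ℕ) : ℝ) ≤ b := by exact_mod_cast hkb
        push_cast at this
        linarith
      · have h1 : b * (f i * r + 0) = b * f i * r + 0 := by ring
        rw [h1]
        refine ⟨hA.snoc (by lia) h.zero_notMem, ?_⟩
        rcases hB with hB | ⟨x, hx, hxl⟩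
        · exact .inl (by simp [hB])
        · right
          have h2 : ((b * f i * r + 0 : ℕ) : ℝ) / (r : ℝ) ^ (n + 1) =
              ((b * f i : ℕ) : ℝ) / (r : ℝ) ^ n := by
            rw [pow_succ]; push_cast; field_simp; ring
          rw [h2]
          refine ⟨x, hx, le_trans ?_ hxl⟩
          gcongr
          · exact_mod_cast (by lia : 1 ≤ r)
          · lia

/-- Right ends of long gaps lie on the grid, hence so do their sums. Conversely, N is split as b Y +
c with c < b, and Y by `exists_digit_split`. The number of summands does not depend on n, so a
single formula serves all levels. -/
theorem mem_grid_iff (n : ℕ) (x : ℝ) :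
    (∃ N ≤ r ^ n, x = N / (r : ℝ) ^ n) ↔ x ≤ 1 ∧ ∃ y : Fin (r - 1) → ℝ, ∃ c : Fin b,
      (∀ i, y i = 0 ∨ ∃ x', IsGap (genCantorSet r K) x' (y i) ∧ 1 / (r : ℝ) ^ n ≤ y i - x') ∧
      x = ∑ i, y i + (c : ℕ) * (1 / (r : ℝ) ^ n) := by
  have h0 := h.pos'
  have hr := h.three_le
  have hk := h.pos
  have hkb := h.k_lt
  have hp : 0 < (r : ℝ) ^ n := by positivity
  constructor
  · rintro ⟨N, hN, rfl⟩
    have hN' : (N : ℝ) ≤ (r : ℝ) ^ n := by exact_mod_cast hN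
    refine ⟨by rwa [div_le_one hp], ?_⟩
    have hrn : 0 < r ^ n := by positivity
    -- Here b ≥ 2, because 1 ≤ k < b; this covers N = r^n as well.
    have hlt : N / b < r ^ n :=
      (Nat.div_le_div_right hN).trans_lt (Nat.div_lt_self hrn (by lia))
    obtain ⟨f, hf, hfi⟩ := h.exists_digit_split n (N / b) hlt
    refine ⟨fun i => ((b * f i : ℕ) : ℝ) / (r : ℝ) ^ n, ⟨N % b, Nat.mod_lt _ (by lia)⟩,
      fun i => ?_, ?_⟩
    · rcases (hfi i).2 with h1 | h1
      · left; simp [h1]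
      · exact .inr h1
    · rw [← Finset.sum_div, ← Nat.cast_sum, ← Finset.mul_sum, ← hf, mul_one_div, ← add_div,
        ← Nat.cast_add, Nat.div_add_mod]
  · rintro ⟨hx1, y, c, hy, hx⟩
    have : ∀ i, ∃ N : ℕ, y i = N / (r : ℝ) ^ n := fun i => by
      rcases hy i with h1 | ⟨x', h1, h2⟩
      · exact ⟨0, by simp [h1]⟩
      · exact h1.right_eq_natCast_div (by lia) h.zero_mem h2
    choose N hN using this
    have hxN : x = (∑ i, N i + c : ℕ) / (r : ℝ) ^ n := by
      rw [hx, Finset.sum_congr rfl fun i _ => hN i, ← Finset.sum_div]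
      push_cast
      ring
    refine ⟨_, ?_, hxN⟩
    rw [hxN, div_le_one hp] at hx1
    exact_mod_cast hx1

end FirstRun

end CantorGrid

/-! ### Definable grids, digits, and reals as codes for sets of naturals -/

/-- `u = b ^ (-n)` for some `n` and `x` is a multiple of `u` in `[0, 1]`. -/
def Grid (b : ℕ) (u x : ℝ) : Prop :=
  ∃ n N : ℕ, N ≤ b ^ n ∧ u = 1 / (b : ℝ) ^ n ∧ x = N / (b : ℝ) ^ n

/-- `u` is a nonpositive power of `b`. -/
def IsInvPow (b : ℕ) (u : ℝ) : Prop := ∃ n : ℕ, u = 1 / (b : ℝ) ^ n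

theorem isInvPow_iff_grid {b : ℕ} {u : ℝ} : IsInvPow b u ↔ Grid b u 0 :=
  ⟨fun ⟨n, hn⟩ => ⟨n, 0, by simp, hn, by simp⟩, fun ⟨n, _, _, hn, _⟩ => ⟨n, hn⟩⟩

theorem one_div_pow_inj {b : ℕ} (hb : 2 ≤ b) {m n : ℕ} :
    1 / (b : ℝ) ^ m = 1 / (b : ℝ) ^ n ↔ m = n := by
  rw [one_div, one_div, inv_inj]
  have h1 : (1 : ℝ) < b := by exact_mod_cast hb
  exact (pow_right_injective₀ (by linarith) h1.ne').eq_iff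

theorem one_div_pow_le_iff {b : ℕ} (hb : 2 ≤ b) {m n : ℕ} :
    1 / (b : ℝ) ^ m ≤ 1 / (b : ℝ) ^ n ↔ n ≤ m := by
  have h1 : (1 : ℝ) < b := by exact_mod_cast hb
  rw [one_div_le_one_div (by positivity) (by positivity)]
  exact pow_le_pow_iff_right₀ h1

theorem one_div_pow_lt_iff {b : ℕ} (hb : 2 ≤ b) {m n : ℕ} :
    1 / (b : ℝ) ^ m < 1 / (b : ℝ) ^ n ↔ n < m := by
  rw [← not_le, one_div_pow_le_iff hb, not_le]

section

variable (L : FirstOrder.Language.{0, 0}) [L.Structure ℝ]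

/-- The grids `b ^ (-n) ℤ ∩ [0, 1]` are uniformly definable with parameters. -/
def HasBase (b : ℕ) : Prop := Dfn L Set.univ (fun q : ℝ × ℝ => Grid b q.1 q.2)

variable {L}

theorem HasBase.isInvPow {b : ℕ} (h : HasBase L b) : Dfn L Set.univ (IsInvPow b) :=
  (Dfn.comp₂ h (f := fun p : ℝ => p) (g := fun _ => (0 : ℝ)) (by fun_prop) (by fun_prop)).of_iff
    fun _ => isInvPow_iff_grid

variable [OrderAddDefinable L]

theorem Dfn.isGap {A : Set ℝ} {X : Set ℝ} (hX : Dfn L A (fun x : ℝ => x ∈ X)) :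
    Dfn L A (fun q : ℝ × ℝ => IsGap X q.1 q.2) := by
  refine (hX.comp (by fun_prop)).and ((hX.comp (by fun_prop)).and
    ((Dfn.lt (by fun_prop) (by fun_prop)).and (Dfn.all ((hX.comp (by fun_prop)).imp
      ((Dfn.le (by fun_prop) (by fun_prop)).or (Dfn.le (by fun_prop) (by fun_prop)))))))

theorem FirstRun.hasBase_sq {r k b : ℕ} {K : Set ℕ} (h : FirstRun r K k b)
    (hC : Dfn L Set.univ (fun x : ℝ => x ∈ genCantorSet r K)) : HasBase L (r ^ 2) := by
  have hgap := hC.isGap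
  set C := genCantorSet r K with hCdef
  have hE : Dfn L Set.univ (fun e : ℝ =>
      ∃ x z : ℝ, IsGap C x z ∧ z - x = ((b - k : ℕ) : ℝ) * e ∧
      z ≤ b / ((r : ℝ) ^ 2 - 1) ∧ (r : ℝ) * (b / ((r : ℝ) ^ 2 - 1)) < r * z + (z - x)) := by
    refine Dfn.ex (Dfn.ex ((hgap.comp₂ (by fun_prop) (by fun_prop)).and
      ((Dfn.eq (by fun_prop) (by fun_prop)).and ((Dfn.le (by fun_prop) (by fun_prop)).and
        (Dfn.lt (by fun_prop) (by fun_prop))))))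
  have hR : Dfn L Set.univ (fun q : ℝ × ℝ => q.2 ≤ 1 ∧ ∃ y : Fin (r - 1) → ℝ, ∃ c : Fin b,
      (∀ i, y i = 0 ∨ ∃ x', IsGap C x' (y i) ∧ q.1 ≤ y i - x') ∧
      q.2 = ∑ i, y i + (c : ℕ) * q.1) := by
    refine (Dfn.le (by fun_prop) (by fun_prop)).and (Dfn.ex (Dfn.exists_finite fun c =>
      (Dfn.forall_finite fun i => (Dfn.eq (by fun_prop) (by fun_prop)).or (Dfn.ex
        ((hgap.comp₂ (by fun_prop) (by fun_prop)).and (Dfn.le (by fun_prop) (by fun_prop))))).and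
      (Dfn.eq (by fun_prop) (DFun.add (DFun.finset_sum _ fun i => by fun_prop) (by fun_prop)))))
  -- The gap test yields only r^(-2), r^(-4), …; the step u = 1 is added separately.
  have h1 : Dfn L Set.univ (fun q : ℝ × ℝ => q.1 = 1) := Dfn.eq (by fun_prop) (by fun_prop)
  refine ((h1.or hE.fst).and hR).of_iff fun q => ?_
  obtain ⟨u, x⟩ := q
  have hEu := h.exists_gap_iff u
  rw [← hCdef] at hEu
  simp only
  rw [hEu]
  constructor
  · rintro ⟨n, N, hN, rfl, rfl⟩
    have hpow : (((r ^ 2 : ℕ) : ℝ)) ^ n = (r : ℝ) ^ (2 * n) := by push_cast; ring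
    rw [hpow]
    refine ⟨?_, (h.mem_grid_iff (2 * n) _).1 ⟨N, by rwa [pow_mul], rfl⟩⟩
    cases n with
    | zero => simp
    | succ i => exact .inr ⟨i, rfl⟩
  · rintro ⟨hu, hx⟩
    obtain ⟨n, rfl⟩ : ∃ n, u = 1 / (r : ℝ) ^ (2 * n) := by
      rcases hu with rfl | ⟨i, rfl⟩
      · exact ⟨0, by simp⟩
      · exact ⟨i + 1, rfl⟩
    obtain ⟨N, hN, rfl⟩ := (h.mem_grid_iff (2 * n) x).2 hx
    have hpow : (((r ^ 2 : ℕ) : ℝ)) ^ n = (r : ℝ) ^ (2 * n) := by push_cast; ring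
    exact ⟨n, N, by rwa [← pow_mul], by rw [hpow], by rw [hpow]⟩

/-- The digit of `x` in base `b` following the position of `u = b ^ (-n)` is `d`. -/
def HasDigit (b d : ℕ) (u x : ℝ) : Prop :=
  ∃ z, Grid b u z ∧ (b : ℝ) * z + d * u ≤ b * x ∧ (b : ℝ) * x < b * z + (d + 1 : ℕ) * u

theorem HasBase.hasDigit {b : ℕ} (h : HasBase L b) (d : ℕ) :
    Dfn L Set.univ (fun q : ℝ × ℝ => HasDigit b d q.1 q.2) := by
  refine Dfn.ex ((h.comp₂ (by fun_prop) (by fun_prop)).and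
    ((Dfn.le (by fun_prop) (by fun_prop)).and (Dfn.lt (by fun_prop) (by fun_prop))))

end

/-- The witness z = N / b^n is the truncation of x to n digits; after scaling, the two inequalities
say that the floor of b^(n+1) x is N b + d. -/
theorem hasDigit_iff {b : ℕ} (hb : 2 ≤ b) {d : ℕ} {x : ℝ} (hx : x ∈ Set.Ico (0 : ℝ) 1)
    (hd : d < b) (n : ℕ) :
    HasDigit b d (1 / (b : ℝ) ^ n) x ↔ ⌊(b : ℝ) ^ (n + 1) * x⌋₊ % b = d := by
  have hb0 : (0 : ℝ) < b := by exact_mod_cast (by lia : 0 < b)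
  have hp : 0 < (b : ℝ) ^ n := by positivity
  have hp1 : 0 ≤ (b : ℝ) ^ (n + 1) * x := mul_nonneg (by positivity) hx.1
  have key : ∀ N : ℕ, ((b : ℝ) * (N / (b : ℝ) ^ n) + d * (1 / (b : ℝ) ^ n) ≤ b * x ∧
      (b : ℝ) * x < b * (N / (b : ℝ) ^ n) + (d + 1 : ℕ) * (1 / (b : ℝ) ^ n)) ↔
      ⌊(b : ℝ) ^ (n + 1) * x⌋₊ = N * b + d := fun N => by
    rw [Nat.floor_eq_iff hp1]
    refine and_congr ?_ ?_
    · rw [← mul_le_mul_iff_right₀ hp]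
      push_cast
      refine iff_of_eq (congrArg₂ _ ?_ ?_)
      · field_simp
      · ring
    · rw [← mul_lt_mul_iff_right₀ hp]
      push_cast
      refine iff_of_eq (congrArg₂ _ ?_ ?_)
      · ring
      · field_simp
        ring
  constructor
  · rintro ⟨z, ⟨n', N, hN, hn, rfl⟩, h⟩
    obtain rfl := (one_div_pow_inj hb).1 hn
    rw [(key N).1 h, Nat.mul_add_mod', Nat.mod_eq_of_lt hd]
  · intro h
    refine ⟨_, ⟨n, ⌊(b : ℝ) ^ (n + 1) * x⌋₊ / b, ?_, rfl, rfl⟩, (key _).2 ?_⟩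
    · apply Nat.div_le_of_le_mul
      rw [← pow_succ']
      apply Nat.floor_le_of_le
      push_cast
      have := hx.2
      nlinarith [pow_pos hb0 (n + 1)]
    · rw [← h, Nat.div_add_mod']

theorem eq_of_hasDigit_iff {b : ℕ} (hb : 2 ≤ b) {x y : ℝ} (hx : x ∈ Set.Ico (0 : ℝ) 1)
    (hy : y ∈ Set.Ico (0 : ℝ) 1)
    (h : ∀ n, ∀ d < b, HasDigit b d (1 / (b : ℝ) ^ n) x ↔ HasDigit b d (1 / (b : ℝ) ^ n) y) :
    x = y := by
  have : NeZero b := ⟨by lia⟩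
  rw [← Real.ofDigits_digits (by lia : 1 < b) hx, ← Real.ofDigits_digits (by lia : 1 < b) hy]
  congr 1
  funext n
  have hlt : ⌊(b : ℝ) ^ (n + 1) * x⌋₊ % b < b := Nat.mod_lt _ (by lia)
  have h1 := (hasDigit_iff hb hy hlt n).1 ((h n _ hlt).1 ((hasDigit_iff hb hx hlt n).2 rfl))
  apply Fin.ext
  simp only [Real.digits, Fin.val_ofNat]
  rw [mul_comm x, mul_comm y, h1]

/-- The code has digits 0 and 1 only. Since b ≥ 3, every tail is less than 1, so these are the
digits that `HasDigit` sees. -/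
theorem exists_hasDigit_one_iff {b : ℕ} (hb : 3 ≤ b) (S : Set ℕ) :
    ∃ c : ℝ, ∀ n, HasDigit b 1 (1 / (b : ℝ) ^ n) c ↔ n ∈ S := by
  classical
  let a : ℕ → Fin b := fun n => if n ∈ S then ⟨1, by lia⟩ else ⟨0, by lia⟩
  have hb0 : (0 : ℝ) < b := by exact_mod_cast (by lia : 0 < b)
  have hlt : ∀ a' : ℕ → Fin b, (∀ n, (a' n : ℕ) ≤ 1) → Real.ofDigits a' < 1 := fun a' ha' => by
    have h1 := Real.ofDigits_eq_sum_add_ofDigits a' 1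
    have h2 := Real.ofDigits_le_one fun i => a' (i + 1)
    simp only [Finset.range_one, Real.ofDigitsTerm, Finset.sum_singleton, zero_add,
      pow_one] at h1
    have h3 : ((a' 0 : ℕ) : ℝ) ≤ 1 := by exact_mod_cast ha' 0
    have h4 : (b : ℝ)⁻¹ ≤ 1 / 3 := by
      rw [one_div]
      exact inv_anti₀ (by norm_num) (by exact_mod_cast hb)
    have h5 : 0 < (b : ℝ)⁻¹ := by positivity
    rw [h1]
    nlinarith
  have ha : ∀ n, (a n : ℕ) ≤ 1 := fun n => by simp only [a]; split_ifs <;> simp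
  have hsum : ∀ n, ∃ M : ℕ,
      (b : ℝ) ^ n * ∑ i ∈ Finset.range n, Real.ofDigitsTerm a i = M := fun n => by
    induction n with
    | zero => exact ⟨0, by simp⟩
    | succ n ih =>
      obtain ⟨M, hM⟩ := ih
      refine ⟨M * b + a n, ?_⟩
      rw [Finset.sum_range_succ, mul_add, pow_succ, mul_right_comm, hM, Real.ofDigitsTerm]
      push_cast
      congr 1
      field_simp
      ring
  have hfloor : ∀ n, ⌊(b : ℝ) ^ (n + 1) * Real.ofDigits a⌋₊ % b = a n := fun n => by
    obtain ⟨M, hM⟩ := hsum n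
    have h1 := Real.ofDigits_eq_sum_add_ofDigits a (n + 1)
    have h2 := Real.ofDigits_nonneg fun i => a (i + (n + 1))
    have h3 := hlt (fun i => a (i + (n + 1))) fun i => ha _
    have h4 : (b : ℝ) ^ (n + 1) * Real.ofDigits a =
        (M * b + a n : ℕ) + Real.ofDigits fun i => a (i + (n + 1)) := by
      rw [h1, mul_add, Finset.sum_range_succ, mul_add, pow_succ, mul_right_comm, hM,
        Real.ofDigitsTerm]
      push_cast
      congr 1
      · congr 1
        field_simp
        ring
      · field_simp
    have h5 : ⌊(b : ℝ) ^ (n + 1) * Real.ofDigits a⌋₊ = M * b + a n := by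
      rw [h4, Nat.floor_eq_iff (by positivity)]
      constructor <;> linarith
    rw [h5, Nat.mul_add_mod', Nat.mod_eq_of_lt (a n).2]
  refine ⟨Real.ofDigits a, fun n => ?_⟩
  rw [hasDigit_iff (by lia) ⟨Real.ofDigits_nonneg a, hlt a ha⟩ (by lia), hfloor]
  simp only [a]
  split_ifs with h <;> simp [h]

section

variable {L : FirstOrder.Language.{0, 0}} [L.Structure ℝ] [OrderAddDefinable L]

theorem HasBase.dfn_of_set {b : ℕ} (hb : 3 ≤ b) (h : HasBase L b) (S : Set ℕ) :
    Dfn L Set.univ (fun u : ℝ => ∃ n ∈ S, u = 1 / (b : ℝ) ^ n) := by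
  obtain ⟨c, hc⟩ := exists_hasDigit_one_iff hb S
  have h1 : Dfn L Set.univ (fun u : ℝ => HasDigit b 1 u c) :=
    (h.hasDigit 1).comp₂ (by fun_prop) (by fun_prop)
  refine (h.isInvPow.and h1).of_iff fun u => ?_
  constructor
  · rintro ⟨n, hn, rfl⟩
    exact ⟨⟨n, rfl⟩, (hc n).2 hn⟩
  · rintro ⟨⟨n, rfl⟩, h2⟩
    exact ⟨n, (hc n).1 h2, rfl⟩

/-- The base b^q grids are the base b grids at exponents divisible by q, and every set of exponents
is definable. -/
theorem HasBase.pow {b : ℕ} (hb : 3 ≤ b) (h : HasBase L b) (q : ℕ) : HasBase L (b ^ q) := by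
  refine (h.and (h.dfn_of_set hb {n | q ∣ n}).fst).of_iff fun p => ?_
  obtain ⟨u, x⟩ := p
  constructor
  · rintro ⟨n, N, hN, rfl, rfl⟩
    have hpow : (((b ^ q : ℕ) : ℝ)) ^ n = (b : ℝ) ^ (q * n) := by push_cast; ring
    rw [hpow]
    exact ⟨⟨q * n, N, by rwa [pow_mul], rfl, rfl⟩, q * n, ⟨n, rfl⟩, rfl⟩
  · rintro ⟨⟨m, N, hN, rfl, rfl⟩, m', ⟨n, rfl⟩, h2⟩
    obtain rfl := (one_div_pow_inj (by lia)).1 h2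
    have hpow : (((b ^ q : ℕ) : ℝ)) ^ n = (b : ℝ) ^ (q * n) := by push_cast; ring
    exact ⟨n, N, by rwa [← pow_mul], by rw [hpow], by rw [hpow]⟩

end

/-! ### Distances between grids in two bases -/

section LcmGrowth

/-- Bézout with bounded coefficients: the bounds keep the resulting fractions inside [0, 1], where
the grids live. -/
theorem exists_mul_eq_mul_add_one {m₁ m₂ : ℕ} (h1 : 0 < m₁) (h2 : 0 < m₂)
    (h : Nat.Coprime m₁ m₂) : ∃ a c, a ≤ m₁ ∧ c ≤ m₂ ∧ a * m₂ = c * m₁ + 1 := by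
  rcases (show 1 ≤ m₁ from h1).eq_or_lt with rfl | h1'
  · exact ⟨1, m₂ - 1, le_rfl, by lia, by lia⟩
  obtain ⟨a, ha, ha'⟩ := Nat.exists_mul_mod_eq_one_of_coprime h.symm h1'
  refine ⟨a, m₂ * a / m₁, ha.le, ?_, ?_⟩
  · exact Nat.div_le_of_le_mul (by rw [mul_comm m₁]; exact Nat.mul_le_mul_left _ ha.le)
  · have := Nat.div_add_mod' (m₂ * a) m₁
    rw [ha'] at this
    rw [this, mul_comm]

/-- Over the common denominator lcm(R^n, b^m) every positive difference has numerator at least 1,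
and Bézout attains 1. -/
theorem le_one_div_lcm_iff {R b : ℕ} (hR : 2 ≤ R) (hb : 2 ≤ b) (n m : ℕ) (c : ℝ) :
    (∀ x y, Grid R (1 / (R : ℝ) ^ n) x → Grid b (1 / (b : ℝ) ^ m) y → y < x → c ≤ x - y) ↔
      c ≤ 1 / (Nat.lcm (R ^ n) (b ^ m) : ℕ) := by
  obtain ⟨m₁, m₂, hcop, h1, h2⟩ := Nat.exists_coprime (R ^ n) (b ^ m)
  set g := Nat.gcd (R ^ n) (b ^ m) with hg
  have hR0 : 0 < R ^ n := by positivity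
  have hb0 : 0 < b ^ m := by positivity
  have hg0 : 0 < g := Nat.gcd_pos_of_pos_left _ hR0
  have hm1 : 0 < m₁ := Nat.pos_of_mul_pos_right (h1 ▸ hR0)
  have hm2 : 0 < m₂ := Nat.pos_of_mul_pos_right (h2 ▸ hb0)
  have hlcm : Nat.lcm (R ^ n) (b ^ m) = m₁ * m₂ * g := by
    apply Nat.eq_of_mul_eq_mul_left hg0
    rw [hg, Nat.gcd_mul_lcm, ← hg, h1, h2]
    ring
  have h1r : (R : ℝ) ^ n = m₁ * g := by exact_mod_cast h1
  have h2r : (b : ℝ) ^ m = m₂ * g := by exact_mod_cast h2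
  have hgr : (0 : ℝ) < g := by exact_mod_cast hg0
  have hm1r : (0 : ℝ) < m₁ := by exact_mod_cast hm1
  have hm2r : (0 : ℝ) < m₂ := by exact_mod_cast hm2
  rw [hlcm]
  constructor
  · intro h
    obtain ⟨a, d, ha, hd, had⟩ := exists_mul_eq_mul_add_one hm1 hm2 hcop
    have hadr : (a : ℝ) * m₂ = d * m₁ + 1 := by exact_mod_cast had
    have hdiff : (a : ℝ) / (R : ℝ) ^ n - d / (b : ℝ) ^ m = 1 / (m₁ * m₂ * g : ℕ) := by
      rw [h1r, h2r]
      push_cast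
      field_simp
      linarith
    rw [← hdiff]
    refine h _ _ ⟨n, a, ?_, rfl, rfl⟩ ⟨m, d, ?_, rfl, rfl⟩ (sub_pos.1 ?_)
    · rw [h1]; exact ha.trans (Nat.le_mul_of_pos_right _ hg0)
    · rw [h2]; exact hd.trans (Nat.le_mul_of_pos_right _ hg0)
    · rw [hdiff]; positivity
  · rintro hc x y ⟨n', N, -, hn, rfl⟩ ⟨m', N', -, hm, rfl⟩ hlt
    obtain rfl := (one_div_pow_inj hR).1 hn
    obtain rfl := (one_div_pow_inj hb).1 hm
    have hdiff : (N : ℝ) / (R : ℝ) ^ n - N' / (b : ℝ) ^ m =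
        (N * m₂ - N' * m₁) / (m₁ * m₂ * g : ℕ) := by
      rw [h1r, h2r]
      push_cast
      field_simp
    refine hc.trans ?_
    rw [hdiff]
    have hpos : (0 : ℝ) < (m₁ * m₂ * g : ℕ) := by positivity
    gcongr
    have h3 : (0 : ℝ) < N * m₂ - N' * m₁ := by
      have := sub_pos.2 hlt
      rw [hdiff] at this
      exact (div_pos_iff_of_pos_right hpos).1 this
    have h4 : N' * m₁ < N * m₂ := by
      have : (N' : ℝ) * m₁ < N * m₂ := by linarith
      exact_mod_cast this
    have h5 : (N' : ℝ) * m₁ + 1 ≤ N * m₂ := by exact_mod_cast h4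
    linarith

theorem log_natCast_eq_sum {N : ℕ} {P : Finset ℕ} (hP : N.primeFactors ⊆ P) :
    Real.log N = ∑ p ∈ P, N.factorization p * Real.log p := by
  rw [Real.log_nat_eq_sum_factorization, Finsupp.sum, Nat.support_factorization]
  refine Finset.sum_subset hP fun p _ hp => ?_
  rw [← Nat.support_factorization, Finsupp.notMem_support_iff] at hp
  simp [hp]

/-- With R = ∏ p^(a p), S = ∏ p^(b p) and n = clog R (S^M), the p-adic valuation of the lcm is max(n
a p, M b p), and θ M ≤ n ≤ θ M + 1. So its logarithm is M σ up to an error of at most log R, where σ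
= Σ max(θ a p, b p) log p, and κ = σ / log S. -/
theorem exists_log_lcm_growth {R S : ℕ} (hR : 2 ≤ R) (hS : 2 ≤ S)
    (hirr : Irrational (Real.logb R S)) :
    ∃ κ : ℝ, 1 < κ ∧ ∀ M : ℕ,
      κ * M * Real.log S ≤ Real.log (Nat.lcm (R ^ Nat.clog R (S ^ M)) (S ^ M) : ℕ) ∧
      Real.log (Nat.lcm (R ^ Nat.clog R (S ^ M)) (S ^ M) : ℕ) ≤
        κ * M * Real.log S + Real.log R := by
  set P := R.primeFactors ∪ S.primeFactors with hP
  set a := R.factorization with ha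
  set b := S.factorization with hb
  set θ := Real.logb R S with hθ
  have hlR : 0 < Real.log R := Real.log_pos (by exact_mod_cast hR)
  have hlS : 0 < Real.log S := Real.log_pos (by exact_mod_cast hS)
  have hθR : θ * Real.log R = Real.log S := by
    rw [hθ, Real.logb, div_mul_cancel₀ _ hlR.ne']
  have hθ0 : 0 < θ := Real.logb_pos (by exact_mod_cast hR) (by exact_mod_cast hS)
  have hlp : ∀ p ∈ P, 0 < Real.log p := fun p hp => by
    have : p.Prime := by
      rcases Finset.mem_union.1 hp with h | h <;> exact Nat.prime_of_mem_primeFactors h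
    exact Real.log_pos (by exact_mod_cast this.one_lt)
  have hsR : Real.log R = ∑ p ∈ P, a p * Real.log p := log_natCast_eq_sum Finset.subset_union_left
  have hsS : Real.log S = ∑ p ∈ P, b p * Real.log p := log_natCast_eq_sum Finset.subset_union_right
  set σ := ∑ p ∈ P, max (θ * a p) (b p) * Real.log p with hσ
  -- Equality would give θ a p ≤ b p for all p. Both sides have the same sum weighted by log p,
  -- namely log S, so θ a p = b p throughout and θ is rational.
  have hκ : Real.log S < σ := by
    rw [hsS, hσ]
    by_contra! hcon
    have hle : ∀ p ∈ P, (b p : ℝ) * Real.log p ≤ max (θ * a p) (b p) * Real.log p :=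
      fun p hp => mul_le_mul_of_nonneg_right (le_max_right _ _) (hlp p hp).le
    have heq := (Finset.sum_eq_sum_iff_of_le hle).1 (le_antisymm (Finset.sum_le_sum hle) hcon)
    have hle2 : ∀ p ∈ P, θ * a p * Real.log p ≤ b p * Real.log p := fun p hp => by
      rw [heq p hp]
      exact mul_le_mul_of_nonneg_right (le_max_left _ _) (hlp p hp).le
    have heq2 := (Finset.sum_eq_sum_iff_of_le hle2).1 (by
      rw [← hsS, ← hθR, hsR, Finset.mul_sum]
      exact Finset.sum_congr rfl fun p _ => by ring)
    obtain ⟨p, hp, hpR⟩ := Nat.exists_prime_and_dvd (show R ≠ 1 by lia)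
    have hpm : p ∈ R.primeFactors := Nat.mem_primeFactors.2 ⟨hp, hpR, by lia⟩
    have hpP : p ∈ P := Finset.mem_union_left _ hpm
    have hap : a p ≠ 0 := by
      rw [← Finsupp.mem_support_iff, ha, Nat.support_factorization]
      exact hpm
    have h1 := mul_right_cancel₀ (hlp p hpP).ne' (heq2 p hpP)
    refine hirr ⟨(b p : ℚ) / a p, ?_⟩
    push_cast
    rw [div_eq_iff (by exact_mod_cast hap)]
    exact h1.symm
  refine ⟨σ / Real.log S, by rwa [one_lt_div hlS], fun M => ?_⟩
  set n := Nat.clog R (S ^ M) with hn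
  have hn1 : θ * M ≤ n := by
    have h1 : S ^ M ≤ R ^ n := Nat.le_pow_clog (by lia) _
    have h2 : Real.log ((S : ℝ) ^ M) ≤ Real.log ((R : ℝ) ^ n) :=
      Real.log_le_log (by positivity) (by exact_mod_cast h1)
    rw [Real.log_pow, Real.log_pow, ← hθR] at h2
    nlinarith
  have hn2 : (n : ℝ) ≤ θ * M + 1 := by
    rcases Nat.eq_zero_or_pos n with h0 | h0
    · rw [h0]; push_cast; positivity
    have h1 : R ^ (n - 1) < S ^ M := by
      by_contra! hcon
      have := (Nat.clog_le_iff_le_pow (by lia)).2 hcon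
      lia
    have h2 : Real.log ((R : ℝ) ^ (n - 1)) < Real.log ((S : ℝ) ^ M) :=
      Real.log_lt_log (by positivity) (by exact_mod_cast h1)
    rw [Real.log_pow, Real.log_pow, ← hθR, Nat.cast_sub h0] at h2
    push_cast at h2
    nlinarith
  have hRn : R ^ n ≠ 0 := pow_ne_zero _ (by lia)
  have hSM : S ^ M ≠ 0 := pow_ne_zero _ (by lia)
  have hlcm : Real.log (Nat.lcm (R ^ n) (S ^ M) : ℕ) =
      ∑ p ∈ P, max ((n : ℝ) * a p) (M * b p) * Real.log p := by
    rw [log_natCast_eq_sum (P := P)]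
    · refine Finset.sum_congr rfl fun p _ => ?_
      rw [Nat.factorization_lcm hRn hSM, Nat.factorization_pow, Nat.factorization_pow]
      simp [ha, hb]
    · intro p hp
      obtain ⟨hpp, hpd, -⟩ := Nat.mem_primeFactors.1 hp
      rcases (Nat.Prime.dvd_lcm hpp).1 hpd with h | h
      · exact Finset.mem_union_left _ (Nat.mem_primeFactors.2 ⟨hpp, hpp.dvd_of_dvd_pow h, by lia⟩)
      · exact Finset.mem_union_right _ (Nat.mem_primeFactors.2 ⟨hpp, hpp.dvd_of_dvd_pow h, by lia⟩)
  have hσM : σ / Real.log S * M * Real.log S =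
      ∑ p ∈ P, M * max (θ * a p) (b p) * Real.log p := by
    rw [mul_right_comm, div_mul_cancel₀ _ hlS.ne', hσ, Finset.sum_mul]
    exact Finset.sum_congr rfl fun p _ => by ring
  have hM0 : (0 : ℝ) ≤ M := Nat.cast_nonneg M
  rw [hlcm, hσM]
  constructor
  · refine Finset.sum_le_sum fun p hp => mul_le_mul_of_nonneg_right ?_ (hlp p hp).le
    rw [mul_max_of_nonneg _ _ hM0]
    refine max_le_max ?_ le_rfl
    have : (0 : ℝ) ≤ a p := Nat.cast_nonneg _
    nlinarith
  · rw [hsR, ← Finset.sum_add_distrib]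
    refine Finset.sum_le_sum fun p hp => ?_
    rw [← add_mul]
    refine mul_le_mul_of_nonneg_right ?_ (hlp p hp).le
    rw [mul_max_of_nonneg _ _ hM0]
    have h1 : (0 : ℝ) ≤ a p := Nat.cast_nonneg _
    refine max_le ?_ ?_
    · have := le_max_left ((M : ℝ) * (θ * a p)) (M * b p)
      nlinarith
    · have := le_max_right ((M : ℝ) * (θ * a p)) (M * b p)
      linarith

/-- The exponent of the largest power of `1 / b` below all positive differences between the
`R`-grid at the level of `b ^ (-m)` and the `b`-grid of step `b ^ (-m)`. -/
def lcmJump (R b m : ℕ) : ℕ := Nat.clog b (Nat.lcm (R ^ Nat.clog R (b ^ m)) (b ^ m))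

theorem exists_lcmJump_bounds {R S : ℕ} (hR : 2 ≤ R) (hS : 2 ≤ S)
    (hirr : Irrational (Real.logb R S)) :
    ∃ (κ : ℝ) (q : ℕ), 1 < κ ∧ 0 < q ∧ ∀ m : ℕ,
      κ * m ≤ lcmJump R (S ^ q) m ∧ (lcmJump R (S ^ q) m : ℝ) < κ * (m + 1) := by
  obtain ⟨κ, hκ, h⟩ := exists_log_lcm_growth hR hS hirr
  have hlR : 0 < Real.log R := Real.log_pos (by exact_mod_cast hR)
  have hlS : 0 < Real.log S := Real.log_pos (by exact_mod_cast hS)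
  -- Passing to base S^q with q this large makes the error log R at most κ - 1 when measured in
  -- units of log (S^q).
  obtain ⟨q, hq⟩ := exists_nat_ge (Real.log R / ((κ - 1) * Real.log S))
  have hκS : 0 < (κ - 1) * Real.log S := mul_pos (by linarith) hlS
  have hq0 : 0 < q := by
    have : (0 : ℝ) < q := lt_of_lt_of_le (by positivity) hq
    exact_mod_cast this
  have hqr : (0 : ℝ) < q := by exact_mod_cast hq0
  rw [div_le_iff₀ hκS] at hq
  refine ⟨κ, q, hκ, hq0, fun m => ?_⟩
  have hb1 : 1 < S ^ q := Nat.one_lt_pow hq0.ne' (by lia)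
  obtain ⟨h1, h2⟩ := h (q * m)
  rw [pow_mul] at h1 h2
  rw [lcmJump]
  set Λ := Nat.lcm (R ^ Nat.clog R ((S ^ q) ^ m)) ((S ^ q) ^ m) with hΛ
  have hΛ0 : 0 < Λ := Nat.lcm_pos (by positivity) (by positivity)
  set F := Nat.clog (S ^ q) Λ with hF
  have hlpow : ∀ j : ℕ, Real.log (((S ^ q) ^ j : ℕ) : ℝ) = j * (q * Real.log S) := fun j => by
    push_cast
    rw [Real.log_pow, Real.log_pow]
  have hqS : 0 < q * Real.log S := by positivity
  push_cast at h1 h2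
  constructor
  · have h3 : Λ ≤ (S ^ q) ^ F := Nat.le_pow_clog hb1 _
    have h4 : Real.log Λ ≤ Real.log (((S ^ q) ^ F : ℕ) : ℝ) :=
      Real.log_le_log (by exact_mod_cast hΛ0) (by exact_mod_cast h3)
    rw [hlpow] at h4
    nlinarith
  · rcases Nat.eq_zero_or_pos F with h0 | h0
    · rw [h0]; push_cast; positivity
    have h3 : (S ^ q) ^ (F - 1) < Λ := by
      by_contra! hcon
      have := (Nat.clog_le_iff_le_pow hb1).2 hcon
      lia
    have h4 : Real.log (((S ^ q) ^ (F - 1) : ℕ) : ℝ) < Real.log Λ :=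
      Real.log_lt_log (by positivity) (by exact_mod_cast h3)
    rw [hlpow, Nat.cast_sub h0] at h4
    push_cast at h4
    nlinarith

end LcmGrowth

/-! ### A partial map with infinite fibres and the coding of binary relations -/

section Combinatorics

theorem exists_block_not_mem_range {F : ℕ → ℕ} (hF : StrictMono F) {κ : ℝ} (hκ : 1 < κ)
    (hlow : ∀ m : ℕ, κ * m ≤ F m) (hup : ∀ m : ℕ, (F m : ℝ) < κ * (m + 1)) :
    ∃ B, 0 < B ∧ ∀ n, ∃ a ∉ Set.range F, a / B = n := by
  -- If a whole block of length B lay in the range, B consecutive values would use at least B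
  -- arguments, and the linear bounds would give κ (B - 2) < B - 1. This choice of B forbids it.
  obtain ⟨B, hB⟩ := exists_nat_ge (2 * κ / (κ - 1))
  have hκ1 : 0 < κ - 1 := by linarith
  rw [div_le_iff₀ hκ1] at hB
  have hB0 : 0 < B := by
    rcases Nat.eq_zero_or_pos B with rfl | h
    · push_cast at hB; linarith
    · exact h
  refine ⟨B, hB0, fun n => ?_⟩
  by_contra! hcon
  have hmem : ∀ i < B, ∃ m, F m = B * n + i := fun i hi => by
    by_contra h
    refine hcon (B * n + i) (fun ⟨m, hm⟩ => h ⟨m, hm⟩) ?_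
    rw [Nat.mul_add_div hB0, Nat.div_eq_of_lt hi, add_zero]
  obtain ⟨m0, h0⟩ := hmem 0 hB0
  obtain ⟨m1, h1⟩ := hmem (B - 1) (by lia)
  have hcard : B ≤ m1 + 1 - m0 := by
    have hsub : Finset.Ico (B * n) (B * n + B) ⊆ (Finset.Icc m0 m1).image F := by
      intro x hx
      rw [Finset.mem_Ico] at hx
      obtain ⟨m, hm⟩ := hmem (x - B * n) (by lia)
      refine Finset.mem_image.2 ⟨m, Finset.mem_Icc.2 ⟨?_, ?_⟩, by lia⟩
      · rw [← hF.le_iff_le]; lia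
      · rw [← hF.le_iff_le]; lia
    have := (Finset.card_le_card hsub).trans Finset.card_image_le
    simpa using this
  have h2 := hlow m1
  have h3 := hup m0
  rw [h1] at h2
  rw [h0] at h3
  have h4 : (B : ℝ) + m0 ≤ m1 + 1 := by exact_mod_cast (by lia : B + m0 ≤ m1 + 1)
  push_cast [Nat.cast_sub (show 1 ≤ B from hB0)] at h2 h3
  nlinarith

/-- `x` lies on the forward orbit under `F` of some `a` outside the range of `F` which lies in
the `e`-th block of length `B`. -/
def OrbitBlock (F : ℕ → ℕ) (B x e : ℕ) : Prop :=
  ∃ a, a ∉ Set.range F ∧ (∃ i, F^[i] a = x) ∧ a / B = e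

/-- Injectivity cancels equal numbers of iterations, and a root outside the range has no
predecessor, so x determines its root. -/
theorem OrbitBlock.unique {F : ℕ → ℕ} (hF : F.Injective) {B x e e' : ℕ}
    (h : OrbitBlock F B x e) (h' : OrbitBlock F B x e') : e = e' := by
  obtain ⟨a, ha, ⟨i, hi⟩, rfl⟩ := h
  obtain ⟨a', ha', ⟨j, hj⟩, rfl⟩ := h'
  have key : ∀ i j : ℕ, ∀ a a' : ℕ, a ∉ Set.range F → F^[i] a = F^[i + j] a' → j = 0 ∧ a = a' := by
    intro i j a a' ha hij
    rw [Function.iterate_add_apply] at hij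
    have := hF.iterate i hij
    cases j with
    | zero => exact ⟨rfl, this⟩
    | succ j => exact absurd ⟨_, by rw [this, Function.iterate_succ_apply']⟩ ha
  rcases le_total i j with hij | hij
  · obtain ⟨c, rfl⟩ := Nat.exists_eq_add_of_le hij
    rw [(key i c a a' ha (hi.trans hj.symm)).2]
  · obtain ⟨c, rfl⟩ := Nat.exists_eq_add_of_le hij
    rw [(key j c a' a ha' (hj.trans hi.symm)).2]

/-- A root is not a fixed point, so a < F a and its orbit is strictly increasing. -/
theorem frequently_orbitBlock {F : ℕ → ℕ} (hF : StrictMono F) {B : ℕ}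
    (hB : ∀ n, ∃ a ∉ Set.range F, a / B = n) (e : ℕ) :
    ∃ᶠ x in Filter.atTop, OrbitBlock F B x e := by
  obtain ⟨a, ha, hae⟩ := hB e
  have hlt : a < F a := lt_of_le_of_ne hF.le_apply fun h => ha ⟨a, h.symm⟩
  have hmono := hF.strictMono_iterate_of_lt_map hlt
  rw [Filter.frequently_atTop]
  exact fun N => ⟨_, hmono.le_apply, a, ha, ⟨N, rfl⟩, hae⟩

/-- Every binary relation on `ℕ` is coded by two sets of markers, via a map with infinite
fibres. -/
theorem exists_marker_sets {G : ℕ → ℕ → Prop} (huniq : ∀ x e e', G x e → G x e' → e = e')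
    (hfreq : ∀ e, ∃ᶠ x in Filter.atTop, G x e) (ρ : ℕ → ℕ → Prop) :
    ∃ X Y : Set ℕ, ∀ e e', ρ e e' ↔ ∃ x ∈ X, ∃ y ∈ Y, x < y ∧ (∀ y' ∈ Y, x < y' → y ≤ y') ∧
      G x e ∧ G y e' := by
  by_cases hne : ∃ p : ℕ × ℕ, ρ p.1 p.2
  · obtain ⟨f, hf⟩ := (Set.to_countable {p : ℕ × ℕ | ρ p.1 p.2}).exists_eq_range hne
    -- The pairs of ρ are enumerated by f. Infinite fibres allow a strictly increasing choice of
    -- markers: φ(2j) for the first and φ(2j+1) for the second component of f j.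
    obtain ⟨φ, hφ, hG⟩ := Filter.extraction_forall_of_frequently
      (P := fun n x => G x (if n % 2 = 0 then (f (n / 2)).1 else (f (n / 2)).2))
      fun n => hfreq _
    have h0 : ∀ j, G (φ (2 * j)) (f j).1 := fun j => by simpa using hG (2 * j)
    have h1 : ∀ j, G (φ (2 * j + 1)) (f j).2 := fun j => by
      have := hG (2 * j + 1)
      rwa [if_neg (by lia), show (2 * j + 1) / 2 = j by lia] at this
    refine ⟨Set.range fun j => φ (2 * j), Set.range fun j => φ (2 * j + 1), fun e e' => ?_⟩
    constructor
    · intro hρ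
      obtain ⟨j, hj⟩ : (e, e') ∈ Set.range f := hf ▸ hρ
      refine ⟨_, ⟨j, rfl⟩, _, ⟨j, rfl⟩, hφ (by lia), ?_, by simpa [hj] using h0 j,
        by simpa [hj] using h1 j⟩
      rintro _ ⟨i, rfl⟩ hi
      rw [hφ.lt_iff_lt] at hi
      exact hφ.monotone (by lia)
    · rintro ⟨_, ⟨j, rfl⟩, _, ⟨i, rfl⟩, hlt, hnext, hx, hy⟩
      rw [hφ.lt_iff_lt] at hlt
      -- The next marker of Y after φ(2j) is φ(2j+1), which pairs the two components of the same f
      -- j.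
      have h2 := hnext _ ⟨j, rfl⟩ (hφ (by lia))
      rw [hφ.le_iff_le] at h2
      obtain rfl : i = j := by lia
      have h3 : f i ∈ {p : ℕ × ℕ | ρ p.1 p.2} := hf ▸ ⟨i, rfl⟩
      rw [huniq _ _ _ hx (h0 i), huniq _ _ _ hy (h1 i)]
      exact h3
  · push Not at hne
    exact ⟨∅, ∅, fun e e' => by simpa using hne (e, e')⟩

end Combinatorics

/-! ### Definability of all binary relations on ℕ -/

section

variable {L : FirstOrder.Language.{0, 0}} [L.Structure ℝ] [OrderAddDefinable L]

variable (L) in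
/-- Through the embedding `n ↦ b ^ (-n)` the relation `ρ` on `ℕ` becomes definable. -/
def DfnRel (b b' : ℕ) (ρ : ℕ → ℕ → Prop) : Prop :=
  Dfn L Set.univ
    (fun q : ℝ × ℝ => ∃ m n, ρ m n ∧ q.1 = 1 / (b : ℝ) ^ m ∧ q.2 = 1 / (b' : ℝ) ^ n)

theorem HasBase.dfnRel_lcmJump {R b : ℕ} (hR : 3 ≤ R) (hb : 3 ≤ b) (h : HasBase L R)
    (h' : HasBase L b) : DfnRel L b b (fun m j => j = lcmJump R b m) := by
  have hpR := h.isInvPow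
  have hpb := h'.isInvPow
  have hbound : Dfn L Set.univ (fun q : ℝ × ℝ × ℝ => ∀ x y,
      Grid R q.1 x → Grid b q.2.1 y → y < x → q.2.2 ≤ x - y) := by
    refine Dfn.all (Dfn.all ((h.comp₂ (by fun_prop) (by fun_prop)).imp
      ((h'.comp₂ (by fun_prop) (by fun_prop)).imp
      ((Dfn.lt (by fun_prop) (by fun_prop)).imp (Dfn.le (by fun_prop) (by fun_prop))))))
  -- Here u is the largest power of 1/R below b^(-m), with exponent clog R (b^m), and the second
  -- coordinate is the largest power of 1/b below all positive differences of the two grids.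
  have hD : Dfn L Set.univ (fun q : ℝ × ℝ => IsInvPow b q.1 ∧ IsInvPow b q.2 ∧
      ∃ u : ℝ, (IsInvPow R u ∧ u ≤ q.1 ∧ ∀ u', IsInvPow R u' → u' ≤ q.1 → u' ≤ u) ∧
      (∀ x y, Grid R u x → Grid b q.1 y → y < x → q.2 ≤ x - y) ∧
      ∀ c, IsInvPow b c → (∀ x y, Grid R u x → Grid b q.1 y → y < x → c ≤ x - y) → c ≤ q.2) := by
    refine (hpb.comp (by fun_prop)).and ((hpb.comp (by fun_prop)).and (Dfn.ex ?_))
    refine Dfn.and (Dfn.and (hpR.comp (by fun_prop)) (Dfn.and (Dfn.le (by fun_prop) (by fun_prop))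
      (Dfn.all ((hpR.comp (by fun_prop)).imp ((Dfn.le (by fun_prop) (by fun_prop)).imp
        (Dfn.le (by fun_prop) (by fun_prop)))))))
      (Dfn.and ?_ (Dfn.all ((hpb.comp (by fun_prop)).imp (Dfn.imp ?_
        (Dfn.le (by fun_prop) (by fun_prop))))))
    · exact hbound.comp (f := fun q : (ℝ × ℝ) × ℝ => (q.2, q.1.1, q.1.2)) (by fun_prop)
    · exact hbound.comp (f := fun q : ((ℝ × ℝ) × ℝ) × ℝ => (q.1.2, q.1.1.1, q.2)) (by fun_prop)
  refine hD.of_iff fun q => ?_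
  obtain ⟨v, a⟩ := q
  have hR1 : 1 < R := by lia
  have hb1 : 1 < b := by lia
  have hRle : ∀ m n : ℕ, 1 / (R : ℝ) ^ n ≤ 1 / (b : ℝ) ^ m ↔ Nat.clog R (b ^ m) ≤ n :=
    fun m n => by
      rw [one_div_le_one_div (by positivity) (by positivity), Nat.clog_le_iff_le_pow hR1]
      exact_mod_cast Iff.rfl
  have hble : ∀ Λ j : ℕ, 0 < Λ → (1 / (b : ℝ) ^ j ≤ 1 / (Λ : ℝ) ↔ Nat.clog b Λ ≤ j) :=
    fun Λ j hΛ => by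
      rw [one_div_le_one_div (by positivity) (by exact_mod_cast hΛ), Nat.clog_le_iff_le_pow hb1]
      exact_mod_cast Iff.rfl
  have hΛ : ∀ n m, 0 < Nat.lcm (R ^ n) (b ^ m) := fun n m =>
    Nat.lcm_pos (by positivity) (by positivity)
  constructor
  · rintro ⟨m, j, rfl, rfl, rfl⟩
    refine ⟨⟨m, rfl⟩, ⟨_, rfl⟩, 1 / (R : ℝ) ^ Nat.clog R (b ^ m),
      ⟨⟨_, rfl⟩, (hRle _ _).2 le_rfl, ?_⟩, ?_, ?_⟩
    · rintro _ ⟨n, rfl⟩ hn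
      exact (one_div_pow_le_iff (by lia)).2 ((hRle _ _).1 hn)
    · exact (le_one_div_lcm_iff (by lia) (by lia) _ _ _).2 ((hble _ _ (hΛ _ _)).2 le_rfl)
    · rintro _ ⟨i, rfl⟩ hi
      have := (le_one_div_lcm_iff (by lia) (by lia) _ _ _).1 hi
      exact (one_div_pow_le_iff (by lia)).2 ((hble _ _ (hΛ _ _)).1 this)
  · rintro ⟨⟨m, rfl⟩, ⟨j, rfl⟩, u, ⟨⟨n, rfl⟩, hn, hmax⟩, hj, hjmax⟩
    refine ⟨m, j, ?_, rfl, rfl⟩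
    obtain rfl : n = Nat.clog R (b ^ m) := by
      have h1 := (hRle _ _).1 hn
      have h2 := hmax _ ⟨_, rfl⟩ ((hRle m _).2 le_rfl)
      exact le_antisymm ((one_div_pow_le_iff (by lia)).1 h2) h1
    have h1 := (hble _ _ (hΛ _ _)).1 ((le_one_div_lcm_iff (by lia) (by lia) _ _ _).1 hj)
    have h2 := hjmax _ ⟨_, rfl⟩
      ((le_one_div_lcm_iff (by lia) (by lia) _ _ _).2 ((hble _ _ (hΛ _ _)).2 le_rfl))
    exact le_antisymm ((one_div_pow_le_iff (by lia)).1 h2) h1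

/-- Lying on the orbit of a means belonging to every set that contains a and is closed under F; such
sets are coded by the digits 1 of a real c. The quotient a / B is read off as the exponent of the
least power of b^(-B) that is at least b^(-a). -/
theorem HasBase.dfnRel_orbitBlock {b : ℕ} (hb : 3 ≤ b) (h : HasBase L b) {F : ℕ → ℕ}
    (hF : DfnRel L b b (fun m j => j = F m)) {B : ℕ} (hB : 0 < B) :
    DfnRel L b (b ^ B) (OrbitBlock F B) := by
  have hp := h.isInvPow
  have hpB := (h.pow hb B).isInvPow
  have hdig := h.hasDigit 1
  unfold DfnRel at hF
  set G : ℝ → ℝ → Prop := fun x y => ∃ m n, n = F m ∧ x = 1 / (b : ℝ) ^ m ∧ y = 1 / (b : ℝ) ^ n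
    with hG
  replace hF : Dfn L Set.univ (fun q : ℝ × ℝ => G q.1 q.2) := hF
  have hGiff : ∀ m n, G (1 / (b : ℝ) ^ m) (1 / (b : ℝ) ^ n) ↔ n = F m := fun m n => by
    constructor
    · rintro ⟨m', n', rfl, h1, h2⟩
      rw [(one_div_pow_inj (by lia)).1 h1, (one_div_pow_inj (by lia)).1 h2]
    · rintro rfl
      exact ⟨m, _, rfl, rfl, rfl⟩
  have hD : Dfn L Set.univ (fun q : ℝ × ℝ => ∃ a : ℝ, (IsInvPow b q.1 ∧ IsInvPow b a ∧
      ¬ (∃ v, G v a) ∧ ∀ c, HasDigit b 1 a c →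
        (∀ v w, G v w → HasDigit b 1 v c → HasDigit b 1 w c) → HasDigit b 1 q.1 c) ∧
      IsInvPow (b ^ B) q.2 ∧ a ≤ q.2 ∧ ∀ e, IsInvPow (b ^ B) e → a ≤ e → q.2 ≤ e) := by
    refine Dfn.ex (Dfn.and ((hp.comp (by fun_prop)).and ((hp.comp (by fun_prop)).and
      (Dfn.and (Dfn.not (Dfn.ex (hF.comp₂ (by fun_prop) (by fun_prop)))) (Dfn.all (Dfn.imp
      (hdig.comp₂ (by fun_prop) (by fun_prop)) (Dfn.imp (Dfn.all (Dfn.all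
        ((hF.comp₂ (by fun_prop) (by fun_prop)).imp ((hdig.comp₂ (by fun_prop) (by fun_prop)).imp
          (hdig.comp₂ (by fun_prop) (by fun_prop)))))) (hdig.comp₂ (by fun_prop) (by fun_prop)))))))) ?_)
    refine (hpB.comp (by fun_prop)).and (Dfn.and (Dfn.le (by fun_prop) (by fun_prop))
      (Dfn.all ((hpB.comp (by fun_prop)).imp ((Dfn.le (by fun_prop) (by fun_prop)).imp
        (Dfn.le (by fun_prop) (by fun_prop))))))
  refine hD.of_iff fun q => ?_
  obtain ⟨x, e⟩ := q
  have hpow : ∀ n : ℕ, ((b ^ B : ℕ) : ℝ) ^ n = (b : ℝ) ^ (n * B) := fun n => by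
    push_cast
    rw [← pow_mul, mul_comm]
  have hble : ∀ a n : ℕ, 1 / (b : ℝ) ^ a ≤ 1 / ((b ^ B : ℕ) : ℝ) ^ n ↔ n ≤ a / B := fun a n => by
    rw [hpow, one_div_pow_le_iff (by lia), Nat.le_div_iff_mul_le hB]
  have hbB : 2 ≤ b ^ B := (show 2 ≤ b by lia).trans (Nat.le_self_pow hB.ne' b)
  have horb : ∀ a y : ℕ, (∀ c, HasDigit b 1 (1 / (b : ℝ) ^ a) c →
        (∀ v w, G v w → HasDigit b 1 v c → HasDigit b 1 w c) →
        HasDigit b 1 (1 / (b : ℝ) ^ y) c) ↔ ∃ i, F^[i] a = y := fun a y => by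
    constructor
    · intro h1
      obtain ⟨c, hc⟩ := exists_hasDigit_one_iff hb {z | ∃ i, F^[i] a = z}
      refine (hc y).1 (h1 c ((hc a).2 ⟨0, rfl⟩) ?_)
      rintro _ _ ⟨m, _, rfl, rfl, rfl⟩ hm
      obtain ⟨i, hi⟩ := (hc m).1 hm
      exact (hc _).2 ⟨i + 1, by rw [Function.iterate_succ_apply', hi]⟩
    · rintro ⟨i, rfl⟩ c hc hcl
      induction i with
      | zero => exact hc
      | succ i ih =>
        rw [Function.iterate_succ_apply']
        exact hcl _ _ ((hGiff _ _).2 rfl) ih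
  constructor
  · rintro ⟨y, n, ⟨a, ha, hay, rfl⟩, rfl, rfl⟩
    refine ⟨1 / (b : ℝ) ^ a, ⟨⟨y, rfl⟩, ⟨a, rfl⟩, ?_, (horb a y).2 hay⟩, ⟨_, rfl⟩,
      (hble _ _).2 le_rfl, ?_⟩
    · rintro ⟨_, m, n, rfl, rfl, h2⟩
      exact ha ⟨m, ((one_div_pow_inj (by lia)).1 h2).symm⟩
    · rintro _ ⟨n, rfl⟩ hn
      exact (one_div_pow_le_iff hbB).2 ((hble _ _).1 hn)
  · rintro ⟨_, ⟨⟨y, rfl⟩, ⟨a, rfl⟩, ha, hay⟩, ⟨n, rfl⟩, hn, hnmax⟩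
    refine ⟨y, n, ⟨a, ?_, (horb a y).1 hay, ?_⟩, rfl, rfl⟩
    · rintro ⟨m, rfl⟩
      exact ha ⟨_, (hGiff m _).2 rfl⟩
    · have h1 := (hble _ _).1 hn
      have h2 := (one_div_pow_le_iff hbB).1 (hnmax _ ⟨_, rfl⟩ ((hble a _).2 le_rfl))
      lia

/-- The marker sets of `exists_marker_sets` are definable like any set of exponents. The map n ↦
b^(-n) reverses order, so the next marker is the largest one below. -/
theorem HasBase.dfnRel_of_infinite_fibres {b b' : ℕ} (hb : 3 ≤ b)
    (h : HasBase L b) {G : ℕ → ℕ → Prop} (hG : DfnRel L b b' G)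
    (huniq : ∀ x e e', G x e → G x e' → e = e') (hfreq : ∀ e, ∃ᶠ x in Filter.atTop, G x e)
    (ρ : ℕ → ℕ → Prop) : DfnRel L b' b' ρ := by
  obtain ⟨X, Y, hXY⟩ := exists_marker_sets huniq hfreq ρ
  have hX := h.dfn_of_set hb X
  have hY := h.dfn_of_set hb Y
  unfold DfnRel at hG
  set P : ℝ → Prop := fun u => ∃ n ∈ X, u = 1 / (b : ℝ) ^ n with hP
  set Q : ℝ → Prop := fun u => ∃ n ∈ Y, u = 1 / (b : ℝ) ^ n with hQ
  set H : ℝ → ℝ → Prop := fun x y => ∃ m n, G m n ∧ x = 1 / (b : ℝ) ^ m ∧ y = 1 / (b' : ℝ) ^ n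
    with hH
  replace hG : Dfn L Set.univ (fun q : ℝ × ℝ => H q.1 q.2) := hG
  have hD : Dfn L Set.univ (fun q : ℝ × ℝ => ∃ x y : ℝ, P x ∧ Q y ∧ y < x ∧
      (∀ y', Q y' → y' < x → y' ≤ y) ∧ H x q.1 ∧ H y q.2) := by
    refine Dfn.ex (Dfn.ex ((hX.comp (by fun_prop)).and ((hY.comp (by fun_prop)).and
      ((Dfn.lt (by fun_prop) (by fun_prop)).and (Dfn.and (Dfn.all ((hY.comp (by fun_prop)).imp
        ((Dfn.lt (by fun_prop) (by fun_prop)).imp (Dfn.le (by fun_prop) (by fun_prop)))))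
        ((hG.comp₂ (by fun_prop) (by fun_prop)).and (hG.comp₂ (by fun_prop) (by fun_prop))))))))
  refine hD.of_iff fun q => ?_
  obtain ⟨e, e'⟩ := q
  have hb2 : 2 ≤ b := by lia
  constructor
  · rintro ⟨m, n, hρ, rfl, rfl⟩
    obtain ⟨x, hx, y, hy, hlt, hnext, hGx, hGy⟩ := (hXY m n).1 hρ
    refine ⟨_, _, ⟨x, hx, rfl⟩, ⟨y, hy, rfl⟩, (one_div_pow_lt_iff hb2).2 hlt, ?_,
      ⟨x, m, hGx, rfl, rfl⟩, ⟨y, n, hGy, rfl, rfl⟩⟩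
    rintro _ ⟨y', hy', rfl⟩ hlt'
    exact (one_div_pow_le_iff hb2).2 (hnext y' hy' ((one_div_pow_lt_iff hb2).1 hlt'))
  · rintro ⟨_, _, ⟨x, hx, rfl⟩, ⟨y, hy, rfl⟩, hlt, hnext, ⟨x', m, hGx, hxx, rfl⟩,
      ⟨y', n, hGy, hyy, rfl⟩⟩
    obtain rfl := (one_div_pow_inj hb2).1 hxx
    obtain rfl := (one_div_pow_inj hb2).1 hyy
    refine ⟨m, n, (hXY m n).2 ⟨x, hx, y, hy, (one_div_pow_lt_iff hb2).1 hlt, ?_, hGx, hGy⟩,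
      rfl, rfl⟩
    intro y' hy' hlt'
    exact (one_div_pow_le_iff hb2).1 (hnext _ ⟨y', hy', rfl⟩ ((one_div_pow_lt_iff hb2).2 hlt'))

/-- Two multiplicatively independent bases make every binary relation on `ℕ` definable. -/
theorem exists_base_dfnRel {R S : ℕ} (hR : 3 ≤ R) (hS : 3 ≤ S)
    (hirr : Irrational (Real.logb R S)) (h : HasBase L R) (h' : HasBase L S) :
    ∃ β, 3 ≤ β ∧ HasBase L β ∧ ∀ ρ, DfnRel L β β ρ := by
  obtain ⟨κ, q, hκ, hq, hF⟩ := exists_lcmJump_bounds (by lia) (by lia) hirr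
  have hb : 3 ≤ S ^ q := hS.trans (Nat.le_self_pow hq.ne' S)
  -- The bounds chain as F(m) < κ (m + 1) ≤ F(m + 1).
  have hmono : StrictMono (lcmJump R (S ^ q)) := strictMono_nat_of_lt_succ fun m => by
    have h1 := (hF m).2
    have h2 := (hF (m + 1)).1
    push_cast at h2
    exact_mod_cast h1.trans_le h2
  obtain ⟨B, hB0, hB⟩ := exists_block_not_mem_range hmono hκ (fun m => (hF m).1) fun m => (hF m).2
  have hbase := h'.pow hS q
  have hβ : 3 ≤ (S ^ q) ^ B := hb.trans (Nat.le_self_pow hB0.ne' _)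
  have hG := hbase.dfnRel_orbitBlock hb (h.dfnRel_lcmJump hR hb hbase) hB0
  exact ⟨(S ^ q) ^ B, hβ, hbase.pow hb B, fun ρ =>
    hbase.dfnRel_of_infinite_fibres hb hG
      (fun _ _ _ => OrbitBlock.unique hmono.injective) (frequently_orbitBlock hmono hB) ρ⟩

end

/-! ### Sequences of reals and compact sets -/

section

variable {L : FirstOrder.Language.{0, 0}} [L.Structure ℝ] [OrderAddDefinable L]

/-- For each of the finitely many digits d, the relation that d stands at place n of f m is a binary
relation on ℕ, hence definable; a real in [0, 1) is determined by its digits. -/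
theorem HasBase.dfn_seq_of_mem_Ico {β : ℕ} (hβ : 2 ≤ β) (h : HasBase L β)
    (hrel : ∀ ρ, DfnRel L β β ρ) {f : ℕ → ℝ} (hf : ∀ n, f n ∈ Set.Ico (0 : ℝ) 1) :
    Dfn L Set.univ (fun q : ℝ × ℝ => ∃ n : ℕ, q.1 = 1 / (β : ℝ) ^ n ∧ q.2 = f n) := by
  have hp := h.isInvPow
  set H : ℕ → ℝ → ℝ → Prop := fun d u t => ∃ m n : ℕ,
    HasDigit β d (1 / (β : ℝ) ^ n) (f m) ∧ u = 1 / (β : ℝ) ^ m ∧ t = 1 / (β : ℝ) ^ n with hH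
  have hHd : ∀ d, Dfn L Set.univ (fun q : ℝ × ℝ => H d q.1 q.2) := fun d => hrel _
  have hD : Dfn L Set.univ (fun q : ℝ × ℝ => IsInvPow β q.1 ∧ 0 ≤ q.2 ∧ q.2 < 1 ∧
      ∀ t, IsInvPow β t → ∀ d : Fin β, (HasDigit β d t q.2 ↔ H d q.1 t)) := by
    refine (hp.comp (by fun_prop)).and ((Dfn.le (by fun_prop) (by fun_prop)).and
      ((Dfn.lt (by fun_prop) (by fun_prop)).and (Dfn.all ((hp.comp (by fun_prop)).imp
      (Dfn.forall_finite fun d => Dfn.iff ((h.hasDigit d).comp₂ (by fun_prop) (by fun_prop))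
        ((hHd d).comp₂ (by fun_prop) (by fun_prop)))))))
  refine hD.of_iff fun q => ?_
  obtain ⟨u, y⟩ := q
  have hHiff : ∀ (d m n : ℕ), H d (1 / (β : ℝ) ^ m) (1 / (β : ℝ) ^ n) ↔
      HasDigit β d (1 / (β : ℝ) ^ n) (f m) := fun d m n => by
    constructor
    · rintro ⟨m', n', hd, h1, h2⟩
      rw [one_div_pow_inj hβ] at h1 h2
      rwa [h1, h2]
    · exact fun hd => ⟨m, n, hd, rfl, rfl⟩
  constructor
  · rintro ⟨m, rfl, rfl⟩
    refine ⟨⟨m, rfl⟩, (hf m).1, (hf m).2, ?_⟩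
    rintro _ ⟨n, rfl⟩ d
    exact (hHiff _ _ _).symm
  · rintro ⟨⟨m, rfl⟩, h0, h1, hdig⟩
    exact ⟨m, rfl, eq_of_hasDigit_iff hβ ⟨h0, h1⟩ (hf m) fun n d hd =>
      (hdig _ ⟨n, rfl⟩ ⟨d, hd⟩).trans (hHiff _ _ _)⟩

theorem HasBase.dfn_seq {β : ℕ} (hβ : 2 ≤ β) (h : HasBase L β)
    (hrel : ∀ ρ, DfnRel L β β ρ) {f : ℕ → ℝ} (M : ℕ) (hf : ∀ n, |f n| ≤ M) :
    Dfn L Set.univ (fun q : ℝ × ℝ => ∃ n : ℕ, q.1 = 1 / (β : ℝ) ^ n ∧ q.2 = f n) := by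
  have hM : (0 : ℝ) < (2 * M + 1 : ℕ) := by positivity
  -- An affine map carries [-M, M] into [0, 1); the denominator 2M + 1 keeps the values strictly
  -- below 1.
  have hg := h.dfn_seq_of_mem_Ico hβ hrel (f := fun n => (f n + M) / (2 * M + 1 : ℕ)) fun n => by
    have := abs_le.1 (hf n)
    refine ⟨div_nonneg (by linarith) hM.le, ?_⟩
    rw [div_lt_one hM]
    push_cast
    linarith
  have hD := hg.comp₂ (Γ := (ℝ × ℝ) × ℝ) (f := fun q => q.1.1) (g := fun q => q.2)
    (R := fun u y => ∃ n : ℕ, u = 1 / (β : ℝ) ^ n ∧ y = (f n + M) / (2 * M + 1 : ℕ))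
    (by fun_prop) (by fun_prop)
  have hE : Dfn L Set.univ
      (fun q : (ℝ × ℝ) × ℝ => q.1.2 + (M : ℝ) = ((2 * M + 1 : ℕ) : ℝ) * q.2) :=
    Dfn.eq (by fun_prop) (by fun_prop)
  have hDE : Dfn L Set.univ (fun q : ℝ × ℝ => ∃ y : ℝ,
      (∃ n : ℕ, q.1 = 1 / (β : ℝ) ^ n ∧ y = (f n + M) / (2 * M + 1 : ℕ)) ∧
        q.2 + (M : ℝ) = ((2 * M + 1 : ℕ) : ℝ) * y) := Dfn.ex (hD.and hE)
  refine hDE.of_iff fun q => ?_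
  obtain ⟨u, y⟩ := q
  constructor
  · rintro ⟨n, rfl, rfl⟩
    exact ⟨_, ⟨n, rfl, rfl⟩, (mul_div_cancel₀ _ hM.ne').symm⟩
  · rintro ⟨_, ⟨n, rfl, rfl⟩, h2⟩
    refine ⟨n, rfl, ?_⟩
    dsimp only at h2
    rw [mul_div_cancel₀ _ hM.ne'] at h2
    linarith

/-- A compact set is cut out of a large cube by a bounded sequence of excluded balls. -/
theorem IsCompact.exists_excluded_balls {n : ℕ} {X : Set (Fin n → ℝ)} (hX : IsCompact X) :
    ∃ (M M' : ℕ) (c : ℕ → Fin n → ℝ) (τ : ℕ → ℝ), (∀ k i, |c k i| ≤ M') ∧ (∀ k, |τ k| ≤ M') ∧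
      ∀ x, x ∈ X ↔ (∀ i, |x i| ≤ M) ∧ ∀ k, ¬ (0 < τ k ∧ ∀ i, |x i - c k i| < τ k) := by
  classical
  obtain ⟨M₀, hM₀⟩ := hX.isBounded.exists_norm_le
  obtain ⟨M, hM⟩ := exists_nat_ge (max M₀ 1)
  have hM1 : (1 : ℝ) ≤ M := (le_max_right _ _).trans hM
  have hXM : ∀ x ∈ X, ‖x‖ ≤ M := fun x hx => (hM₀ x hx).trans ((le_max_left _ _).trans hM)
  let d : ℕ → Fin n → ℝ := TopologicalSpace.denseSeq (Fin n → ℝ)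
  let ok : ℕ → Prop := fun k => ‖d k.unpair.1‖ ≤ M + 1 ∧
    Metric.ball (d k.unpair.1) (1 / (k.unpair.2 + 1)) ⊆ Xᶜ
  -- Indices of unsuitable balls get radius 0 and exclude nothing. The norm bound in `ok` keeps the
  -- centres bounded, as `HasBase.dfn_seq` requires.
  let c : ℕ → Fin n → ℝ := fun k => if ok k then d k.unpair.1 else 0
  let τ : ℕ → ℝ := fun k => if ok k then 1 / (k.unpair.2 + 1) else 0
  have hball : ∀ k x, (0 < τ k ∧ ∀ i, |x i - c k i| < τ k) ↔
      ok k ∧ x ∈ Metric.ball (d k.unpair.1) (1 / (k.unpair.2 + 1)) := fun k x => by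
    by_cases hk : ok k
    · have hpos : (0 : ℝ) < 1 / (k.unpair.2 + 1) := by positivity
      simp only [τ, c, if_pos hk, hk, true_and, hpos, Metric.mem_ball, dist_pi_lt_iff hpos,
        Real.dist_eq]
    · simp [τ, if_neg hk, hk]
  have hdens : ∀ x ∉ X, ‖x‖ ≤ M → ∃ k, ok k ∧
      x ∈ Metric.ball (d k.unpair.1) (1 / (k.unpair.2 + 1)) := by
    intro x hx hxM
    obtain ⟨ε, hε, hεX⟩ := Metric.isOpen_iff.1 hX.isClosed.isOpen_compl x hx
    obtain ⟨j, hj⟩ := exists_nat_one_div_lt (half_pos hε)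
    have hpos : (0 : ℝ) < 1 / ((j : ℝ) + 1) := by positivity
    obtain ⟨i, hi⟩ := Metric.denseRange_iff.1
      (TopologicalSpace.denseRange_denseSeq (Fin n → ℝ)) x _ hpos
    have hi' : dist x (d i) < 1 / ((j : ℝ) + 1) := hi
    refine ⟨Nat.pair i j, ⟨?_, ?_⟩, by simpa using hi'⟩
    · simp only [Nat.unpair_pair]
      have h1 : ‖d i‖ ≤ ‖x‖ + dist x (d i) := by
        rw [dist_comm, dist_eq_norm]
        exact norm_le_norm_add_norm_sub' _ _
      have h2 : 1 / ((j : ℝ) + 1) ≤ 1 := by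
        rw [div_le_one (by positivity)]
        linarith [Nat.cast_nonneg (α := ℝ) j]
      linarith
    · simp only [Nat.unpair_pair]
      intro y hy
      apply hεX
      rw [Metric.mem_ball] at hy ⊢
      calc dist y x ≤ dist y (d i) + dist (d i) x := dist_triangle _ _ _
        _ < ε / 2 + ε / 2 := by rw [dist_comm (d i)]; exact add_lt_add (hy.trans hj) (hi'.trans hj)
        _ = ε := by ring
  refine ⟨M, M + 1, c, τ, fun k i => ?_, fun k => ?_, fun x => ?_⟩
  · push_cast
    by_cases hk : ok k
    · simp only [c, if_pos hk]
      exact (norm_le_pi_norm (d k.unpair.1) i).trans hk.1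
    · simp only [c, if_neg hk]
      simp only [Pi.zero_apply, abs_zero]
      linarith
  · push_cast
    by_cases hk : ok k
    · simp only [τ, if_pos hk]
      rw [abs_of_pos (by positivity)]
      have : 1 / ((k.unpair.2 : ℝ) + 1) ≤ 1 := by
        rw [div_le_one (by positivity)]
        linarith [Nat.cast_nonneg (α := ℝ) k.unpair.2]
      linarith
    · simp only [τ, if_neg hk]
      simp only [abs_zero]
      linarith
  · have hnorm : (∀ i, |x i| ≤ M) ↔ ‖x‖ ≤ M := by
      simp only [← Real.norm_eq_abs]
      exact (pi_norm_le_iff_of_nonneg (Nat.cast_nonneg M)).symm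
    rw [hnorm]
    constructor
    · intro hx
      refine ⟨hXM x hx, fun k hk => ?_⟩
      obtain ⟨h1, h2⟩ := (hball k x).1 hk
      exact h1.2 h2 hx
    · rintro ⟨hx, hk⟩
      by_contra hxX
      obtain ⟨k, h1⟩ := hdens x hxX hx
      exact hk k ((hball k x).2 h1)

/-- All binary relations on `ℕ` being definable, so are all compact sets. -/
theorem HasBase.dfn_of_isCompact {β : ℕ} (hβ : 2 ≤ β) (h : HasBase L β)
    (hrel : ∀ ρ, DfnRel L β β ρ) {n : ℕ} {X : Set (Fin n → ℝ)} (hX : IsCompact X) :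
    Dfn L Set.univ (fun x : Fin n → ℝ => x ∈ X) := by
  obtain ⟨M, M', c, τ, hc, hτ, hXiff⟩ := hX.exists_excluded_balls
  have hτ' := h.dfn_seq hβ hrel M' hτ
  have hc' : ∀ i, Dfn L Set.univ (fun q : ℝ × ℝ => ∃ n : ℕ, q.1 = 1 / (β : ℝ) ^ n ∧ q.2 = c n i) :=
    fun i => h.dfn_seq hβ hrel M' fun k => hc k i
  set T : ℝ → ℝ → Prop := fun u t => ∃ n : ℕ, u = 1 / (β : ℝ) ^ n ∧ t = τ n with hT
  set Z : Fin n → ℝ → ℝ → Prop := fun i u t => ∃ n : ℕ, u = 1 / (β : ℝ) ^ n ∧ t = c n i with hZ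
  replace hτ' : Dfn L Set.univ (fun q : ℝ × ℝ => T q.1 q.2) := hτ'
  replace hc' : ∀ i, Dfn L Set.univ (fun q : ℝ × ℝ => Z i q.1 q.2) := hc'
  have hD : Dfn L Set.univ (fun x : Fin n → ℝ => (∀ i, -(M : ℝ) ≤ x i ∧ x i ≤ (M : ℝ)) ∧
      ¬ ∃ u t : ℝ, T u t ∧ 0 < t ∧ ∀ i, ∃ z, Z i u z ∧ x i < z + t ∧ z < x i + t) := by
    refine Dfn.and (Dfn.forall_finite fun i => (Dfn.le (by fun_prop) (by fun_prop)).and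
      (Dfn.le (by fun_prop) (by fun_prop))) (Dfn.not (Dfn.ex (Dfn.ex
      ((hτ'.comp₂ (by fun_prop) (by fun_prop)).and ((Dfn.lt (by fun_prop) (by fun_prop)).and
      (Dfn.forall_finite fun i => Dfn.ex (((hc' i).comp₂ (by fun_prop) (by fun_prop)).and
        ((Dfn.lt (by fun_prop) (by fun_prop)).and (Dfn.lt (by fun_prop) (by fun_prop))))))))))
  refine hD.of_iff fun x => ?_
  rw [hXiff]
  refine and_congr (forall_congr' fun i => abs_le) ?_
  rw [← not_exists, not_iff_not]
  constructor
  · rintro ⟨k, h0, hk⟩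
    refine ⟨_, _, ⟨k, rfl, rfl⟩, h0, fun i => ⟨_, ⟨k, rfl, rfl⟩, ?_⟩⟩
    have := abs_lt.1 (hk i)
    constructor <;> linarith
  · rintro ⟨_, _, ⟨k, rfl, rfl⟩, h0, hk⟩
    refine ⟨k, h0, fun i => ?_⟩
    obtain ⟨_, ⟨k', hkk, rfl⟩, h1, h2⟩ := hk i
    -- The common u forces the radius and all centre coordinates to come from the same index.
    obtain rfl := (one_div_pow_inj hβ).1 hkk
    rw [abs_lt]
    constructor <;> linarith

end

/-! ### The structure with two Cantor sets -/

section

variable (P Q : Set ℝ)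

theorem orderAddDefinable_realExpansion :
    letI := realExpansion P Q
    OrderAddDefinable cantorLanguage := by
  let := realExpansion P Q
  refine ⟨Set.empty_definable_iff.2 ?_, Set.empty_definable_iff.2 ?_⟩
  · refine ⟨Language.Relations.formula₂ (L := cantorLanguage) CantorRel.lt
      (Language.Term.var (0 : Fin 2)) (Language.Term.var (1 : Fin 2)), ?_⟩
    ext v
    simp only [Set.mem_ofPred_eq]
    rfl
  · refine ⟨Language.Term.equal (L := cantorLanguage) (Language.Term.var (0 : Fin 3))
      (Language.Functions.apply₂ (L := cantorLanguage) CantorFunc.add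
        (Language.Term.var (1 : Fin 3)) (Language.Term.var (2 : Fin 3))), ?_⟩
    ext v
    simp only [Set.mem_ofPred_eq, Language.Formula.realize_equal]
    rfl

theorem dfn_realExpansion_fst :
    letI := realExpansion P Q
    Dfn cantorLanguage ∅ (fun x : ℝ => x ∈ P) := by
  let := realExpansion P Q
  refine Set.empty_definable_iff.2 ⟨Language.Relations.formula₁ (L := cantorLanguage) CantorRel.fst
      (Language.Term.var ()), ?_⟩
  ext v
  simp only [Set.mem_ofPred_eq]
  rfl

theorem dfn_realExpansion_snd :
    letI := realExpansion P Q
    Dfn cantorLanguage ∅ (fun x : ℝ => x ∈ Q) := by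
  let := realExpansion P Q
  refine Set.empty_definable_iff.2 ⟨Language.Relations.formula₁ (L := cantorLanguage) CantorRel.snd
      (Language.Term.var ()), ?_⟩
  ext v
  simp only [Set.mem_ofPred_eq]
  rfl

end

theorem definesEveryCompactSet_of_firstRun {r s k b k' b' : ℕ} {K K' : Set ℕ}
    (h : FirstRun r K k b) (h' : FirstRun s K' k' b') (hrs : Irrational (Real.logb r s)) :
    DefinesEveryCompactSet (realExpansion (genCantorSet r K) (genCantorSet s K')) := by
  let := realExpansion (genCantorSet r K) (genCantorSet s K')
  have := orderAddDefinable_realExpansion (genCantorSet r K) (genCantorSet s K')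
  have hbase : HasBase cantorLanguage (r ^ 2) :=
    h.hasBase_sq ((dfn_realExpansion_fst _ _).mono (Set.empty_subset _))
  have hbase' : HasBase cantorLanguage (s ^ 2) :=
    h'.hasBase_sq ((dfn_realExpansion_snd _ _).mono (Set.empty_subset _))
  have hr : 3 ≤ r ^ 2 := h.three_le.trans (Nat.le_self_pow two_ne_zero r)
  have hs : 3 ≤ s ^ 2 := h'.three_le.trans (Nat.le_self_pow two_ne_zero s)
  have hirr : Irrational (Real.logb (r ^ 2 : ℕ) (s ^ 2 : ℕ)) := by
    convert! hrs using 1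
    rw [Real.logb, Real.logb]
    push_cast
    rw [Real.log_pow, Real.log_pow]
    exact mul_div_mul_left _ _ (by norm_num)
  obtain ⟨β, hβ, hbβ, hrel⟩ := exists_base_dfnRel hr hs hirr hbase hbase'
  intro n X hX
  exact hbβ.dfn_of_isCompact (by lia) hrel hX

/-! ### Coding tuples of naturals by powers of 1/2 -/

/-- The tuple of reals coding a vector of natural numbers. -/
noncomputable def encVec {n : ℕ} (v : List.Vector ℕ n) : Fin n → ℝ := fun i => 1 / (2 : ℝ) ^ v.get i

theorem enc_inj {m n : ℕ} : 1 / (2 : ℝ) ^ m = 1 / (2 : ℝ) ^ n ↔ m = n := by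
  exact_mod_cast one_div_pow_inj (b := 2) le_rfl

theorem encVec_injective {n : ℕ} : Function.Injective (encVec : List.Vector ℕ n → Fin n → ℝ) :=
  fun _ _ h => List.Vector.ext fun i => enc_inj.1 (congrFun h i)

theorem exists_encVec {n : ℕ} {x : Fin n → ℝ} (hx : ∀ i, IsInvPow 2 (x i)) :
    ∃ v, x = encVec v := by
  choose a ha using hx
  exact ⟨List.Vector.ofFn a, funext fun i => by simp [encVec, ha i]⟩

theorem isInvPow_encVec {n : ℕ} (v : List.Vector ℕ n) (i : Fin n) : IsInvPow 2 (encVec v i) :=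
  ⟨v.get i, by simp [encVec]⟩

theorem encVec_cons {n : ℕ} (a : ℕ) (v : List.Vector ℕ n) :
    encVec (a ::ᵥ v) = Fin.cons (1 / (2 : ℝ) ^ a) (encVec v) := by
  funext i
  refine Fin.cases ?_ (fun i => ?_) i <;> simp [encVec]

theorem mem_mOfFn_iff {n : ℕ} {g : Fin n → Part ℕ} {w : List.Vector ℕ n} :
    w ∈ List.Vector.mOfFn g ↔ ∀ i, w.get i ∈ g i := by
  induction n with
  | zero =>
    simp only [List.Vector.mOfFn, IsEmpty.forall_iff, iff_true]
    rw [Subsingleton.elim w List.Vector.nil]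
    exact Part.mem_some _
  | succ n ih =>
    rw [← w.cons_head_tail]
    simp only [List.Vector.mOfFn, Part.bind_eq_bind, Part.mem_bind_iff, Fin.forall_fin_succ, ih,
      List.Vector.get_cons_zero, List.Vector.get_cons_succ]
    constructor
    · rintro ⟨a, ha, v, hv, hw⟩
      have := Part.mem_some_iff.1 hw
      have h1 := congrArg List.Vector.head this
      have h2 := congrArg List.Vector.tail this
      simp only [List.Vector.head_cons, List.Vector.tail_cons] at h1 h2
      rw [h1, h2]
      exact ⟨ha, hv⟩
    · rintro ⟨ha, hv⟩
      exact ⟨_, ha, _, hv, Part.mem_some _⟩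

/-- The only limit points of the coded tuples have a vanishing coordinate. -/
theorem mem_of_mem_closure_encVec {n : ℕ} {S : Set (List.Vector ℕ n)} {x : Fin n → ℝ}
    (hx : x ∈ closure (encVec '' S)) (hpos : ∀ i, 0 < x i) : x ∈ encVec '' S := by
  have hN : ∃ N : ℕ, ∀ i, 1 / (2 : ℝ) ^ N < x i := by
    have : ∀ i, ∃ N : ℕ, 1 / (2 : ℝ) ^ N < x i := fun i => by
      obtain ⟨N, hN⟩ := exists_pow_lt_of_lt_one (hpos i) (by norm_num : (1 / 2 : ℝ) < 1)
      exact ⟨N, by rwa [one_div_pow] at hN⟩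
    choose N hN using this
    refine ⟨∑ i, N i, fun i => lt_of_le_of_lt ?_ (hN i)⟩
    have := Finset.single_le_sum (fun i _ => Nat.zero_le (N i)) (Finset.mem_univ i)
    exact_mod_cast (one_div_pow_le_iff (b := 2) le_rfl).2 this
  obtain ⟨N, hN⟩ := hN
  set U : Set (Fin n → ℝ) := {y | ∀ i, 1 / (2 : ℝ) ^ N < y i} with hU
  have hUo : IsOpen U := by
    rw [hU, Set.ofPred_forall]
    exact isOpen_iInter_of_finite fun i => isOpen_lt continuous_const (continuous_apply i)
  -- Coordinates above 2^(-N) bound all entries by N, so only finitely many codes lie in the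
  -- neighbourhood U of x.
  have hfin : (U ∩ encVec '' S).Finite := by
    have : Set.Finite {v : List.Vector ℕ n | ∀ i, v.get i < N} := by
      have h1 : Set.Finite {a : Fin n → ℕ | ∀ i, a i < N} := by
        have := Set.Finite.pi' fun _ : Fin n => Set.finite_lt_nat N
        exact this
      refine (h1.image List.Vector.ofFn).subset fun v hv => ?_
      exact ⟨v.get, hv, List.Vector.ofFn_get v⟩
    refine (this.image encVec).subset ?_
    rintro _ ⟨hy, v, -, rfl⟩
    refine ⟨v, fun i => ?_, rfl⟩
    have := hy i
    simp only [encVec] at this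
    exact (one_div_pow_lt_iff (b := 2) le_rfl).1 (by exact_mod_cast this)
  have h1 := hUo.inter_closure (t := encVec '' S) ⟨hN, hx⟩
  rw [hfin.isClosed.closure_eq] at h1
  exact h1.2

/-! ### Parameter-free definability of partial recursive functions -/

section

variable {L : FirstOrder.Language.{0, 0}} [L.Structure ℝ]

/-- The closure of the bounded set of codes is compact; its extra points have a vanishing coordinate
and are removed by positivity. -/
theorem dfn_encVec [OrderAddDefinable L] (hcomp : ∀ (n : ℕ) (X : Set (Fin n → ℝ)), IsCompact X →
    Dfn L Set.univ (fun x : Fin n → ℝ => x ∈ X)) {n : ℕ} (S : Set (List.Vector ℕ n)) :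
    Dfn L Set.univ (fun x : Fin n → ℝ => x ∈ encVec '' S) := by
  have hK : IsCompact (closure (encVec '' S)) := by
    refine Metric.isCompact_of_isClosed_isBounded isClosed_closure (Bornology.IsBounded.closure ?_)
    refine (Metric.isBounded_closedBall (x := (0 : Fin n → ℝ)) (r := 1)).subset ?_
    rintro _ ⟨v, -, rfl⟩
    rw [mem_closedBall_zero_iff, pi_norm_le_iff_of_nonneg zero_le_one]
    intro i
    rw [encVec, Real.norm_of_nonneg (by positivity)]
    exact div_le_one_of_le₀ (one_le_pow₀ (by norm_num)) (by positivity)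
  have hD : Dfn L Set.univ (fun x : Fin n → ℝ => x ∈ closure (encVec '' S) ∧ ∀ i, 0 < x i) :=
    (hcomp n _ hK).and (Dfn.forall_finite fun i => Dfn.lt (by fun_prop) (by fun_prop))
  refine hD.of_iff fun x => ⟨fun hx => ⟨subset_closure hx, ?_⟩,
    fun hx => mem_of_mem_closure_encVec hx.1 hx.2⟩
  obtain ⟨v, -, rfl⟩ := hx
  intro i
  simp only [encVec]
  positivity

/-- The powers of `1 / 2` are definable without parameters, being characterized among all sets
definable with parameters by first-order conditions. -/
theorem dfn_isInvPow_two [OrderAddDefinable L] (hone : Dfn L ∅ (fun x : ℝ => x = 1))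
    (hpar : Dfn L Set.univ (IsInvPow 2)) : Dfn L ∅ (IsInvPow 2) := by
  obtain ⟨k, Q, c, hQ, hc⟩ := hpar.exists_param
  have h1 : ∀ {Γ : Type} [RealCtx Γ], DFun L ∅ (fun _ : Γ => (1 : ℝ)) := hone.snd
  have hD : Dfn L ∅ (fun x : ℝ => ∃ c, (Q 1 c ∧ (∀ x, Q x c → 0 < x ∧ x ≤ 1 ∧ (x = 1 ∨ Q (x + x) c)) ∧
      ∀ x, Q (x + x) c → Q x c) ∧ Q x c) := by
    have h0 : ∀ {Γ : Type} [RealCtx Γ], DFun L ∅ (fun _ : Γ => (0 : ℝ)) := DFun.zero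
    refine Dfn.ex (Dfn.and (Dfn.and (hQ.comp₂ h1 (by fun_prop)) (Dfn.and (Dfn.all (Dfn.imp
      (hQ.comp₂ (by fun_prop) (by fun_prop)) (Dfn.and (Dfn.lt h0 (by fun_prop))
      (Dfn.and (Dfn.le (by fun_prop) h1) (Dfn.or (Dfn.eq (by fun_prop) h1)
      (hQ.comp₂ (by fun_prop) (by fun_prop))))))) (Dfn.all (Dfn.imp
      (hQ.comp₂ (by fun_prop) (by fun_prop)) (hQ.comp₂ (by fun_prop) (by fun_prop))))))
      (hQ.comp₂ (by fun_prop) (by fun_prop)))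
  refine hD.of_iff fun x => ?_
  have hhalf : ∀ n : ℕ, 1 / (2 : ℝ) ^ (n + 1) + 1 / (2 : ℝ) ^ (n + 1) = 1 / (2 : ℝ) ^ n :=
    fun n => by rw [pow_succ]; field_simp; norm_num
  constructor
  · intro hx
    refine ⟨c, ⟨(hc 1).1 ⟨0, by simp⟩, fun y hy => ?_, fun y hy => ?_⟩, (hc x).1 hx⟩
    · obtain ⟨n, rfl⟩ := (hc y).2 hy
      push_cast
      refine ⟨by positivity, div_le_one_of_le₀ (one_le_pow₀ (by norm_num)) (by positivity), ?_⟩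
      cases n with
      | zero => left; simp
      | succ n =>
        right
        rw [hhalf]
        exact (hc _).1 ⟨n, by simp⟩
    · obtain ⟨n, hn⟩ := (hc _).2 hy
      refine (hc y).1 ⟨n + 1, ?_⟩
      push_cast at hn ⊢
      have := hhalf n
      linarith
  · rintro ⟨c', ⟨-, hc2, -⟩, hx⟩
    -- An element can be doubled inside the set until it equals 1. The set is bounded by 1, so
    -- doubling must stop, and x is a power of 1/2.
    have key : ∀ (N : ℕ) (x : ℝ), Q x c' → 1 < 2 ^ N * x → IsInvPow 2 x := by
      intro N
      induction N with
      | zero =>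
        intro x hx h1
        have := (hc2 x hx).2.1
        simp only [pow_zero, one_mul] at h1
        linarith
      | succ N ih =>
        intro x hx h1
        rcases (hc2 x hx).2.2 with rfl | h2
        · exact ⟨0, by simp⟩
        · obtain ⟨n, hn⟩ := ih _ h2 (by rw [pow_succ] at h1; linarith)
          refine ⟨n + 1, ?_⟩
          push_cast at hn ⊢
          have := hhalf n
          linarith
    obtain ⟨N, hN⟩ := pow_unbounded_of_one_lt (1 / x) (by norm_num : (1 : ℝ) < 2)
    have hx0 := (hc2 x hx).1
    rw [div_lt_iff₀ hx0] at hN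
    exact key N x hx hN

/-- The relation on real tuples coding a relation on natural numbers. -/
def CodedRel {n : ℕ} (ρ : List.Vector ℕ n → ℕ → Prop) (x : Fin n → ℝ) (y : ℝ) : Prop :=
  ∃ v m, ρ v m ∧ x = encVec v ∧ y = 1 / (2 : ℝ) ^ m

variable (L) in
/-- The coded relation of `ρ` is definable without parameters. -/
def NatDfn {n : ℕ} (ρ : List.Vector ℕ n → ℕ → Prop) : Prop :=
  Dfn L ∅ (fun q : (Fin n → ℝ) × ℝ => CodedRel ρ q.1 q.2)

theorem NatDfn.congr {n : ℕ} {ρ σ : List.Vector ℕ n → ℕ → Prop} (h : NatDfn L ρ)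
    (hρσ : ∀ v m, σ v m ↔ ρ v m) : NatDfn L σ := by
  rwa [show σ = ρ from funext fun v => funext fun m => propext (hρσ v m)]

theorem codedRel_enc {n : ℕ} {ρ : List.Vector ℕ n → ℕ → Prop} {v : List.Vector ℕ n} {m : ℕ} :
    CodedRel ρ (encVec v) (1 / (2 : ℝ) ^ m) ↔ ρ v m := by
  constructor
  · rintro ⟨v', m', h, h1, h2⟩
    rwa [encVec_injective h1, enc_inj.1 h2]
  · exact fun h => ⟨v, m, h, rfl, rfl⟩

theorem CodedRel.exists_eq {n : ℕ} {ρ : List.Vector ℕ n → ℕ → Prop} {v : List.Vector ℕ n} {y : ℝ}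
    (h : CodedRel ρ (encVec v) y) : ∃ m, ρ v m ∧ y = 1 / (2 : ℝ) ^ m := by
  obtain ⟨v', m, h, h1, h2⟩ := h
  exact ⟨m, by rwa [encVec_injective h1], h2⟩

theorem DFun.finCons {A : Set ℝ} {Γ : Type} [RealCtx Γ] {n : ℕ} {f : Γ → ℝ} {g : Γ → Fin n → ℝ}
    (hf : DFun L A f) (hg : DFun L A g) :
    DFun L A (fun p => (Fin.cons (f p) (g p) : Fin (n + 1) → ℝ)) := by
  refine DFun.pi fun i => ?_
  refine Fin.cases ?_ (fun i => ?_) i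
  · simpa using hf
  · simpa using DFun.comp (DFun.apply i) hg

theorem NatDfn.comp (hinv : Dfn L ∅ (IsInvPow 2)) {m n : ℕ} {ρ : List.Vector ℕ n → ℕ → Prop}
    {σ : Fin n → List.Vector ℕ m → ℕ → Prop} (hρ : NatDfn L ρ) (hσ : ∀ i, NatDfn L (σ i)) :
    NatDfn L (fun v a => ∃ w, (∀ i, σ i v (w.get i)) ∧ ρ w a) := by
  -- For n = 0 no `σ i` constrains the input, so being a code is demanded explicitly.
  have hD : Dfn L ∅ (fun q : (Fin m → ℝ) × ℝ => (∀ i, IsInvPow 2 (q.1 i)) ∧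
      ∃ w : Fin n → ℝ, (∀ i, CodedRel (σ i) q.1 (w i)) ∧ CodedRel ρ w q.2) :=
    (Dfn.forall_finite fun i => hinv.comp (by fun_prop)).and (Dfn.ex ((Dfn.forall_finite fun i =>
      Dfn.comp₂ (hσ i) (by fun_prop) (by fun_prop)).and (Dfn.comp₂ hρ (by fun_prop) (by fun_prop))))
  refine hD.of_iff fun q => ?_
  obtain ⟨x, y⟩ := q
  constructor
  · rintro ⟨v, a, ⟨w, hw, ha⟩, rfl, rfl⟩
    exact ⟨isInvPow_encVec v, encVec w, fun i => codedRel_enc.2 (hw i), codedRel_enc.2 ha⟩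
  · rintro ⟨hx, _, hw, w, a, ha, rfl, rfl⟩
    obtain ⟨v, rfl⟩ := exists_encVec hx
    exact ⟨v, a, ⟨w, fun i => codedRel_enc.1 (hw i), ha⟩, rfl, rfl⟩

theorem NatDfn.rfind [OrderAddDefinable L] (hinv : Dfn L ∅ (IsInvPow 2)) {n : ℕ} {f : List.Vector ℕ (n + 1) → ℕ}
    (hone : Dfn L ∅ (fun x : ℝ => x = 1)) (hf : NatDfn L fun v a => a = f v) :
    NatDfn L (fun v a => f (a ::ᵥ v) = 0 ∧ ∀ k < a, f (k ::ᵥ v) ≠ 0) := by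
  have h1 : ∀ {Γ : Type} [RealCtx Γ], DFun L ∅ (fun _ : Γ => (1 : ℝ)) := hone.snd
  set G := CodedRel fun v a => a = f v with hG
  have hGd : Dfn L ∅ (fun q : (Fin (n + 1) → ℝ) × ℝ => G q.1 q.2) := hf
  -- The value 0 is coded by 1, and smaller numbers have larger codes.
  have hD : Dfn L ∅ (fun q : (Fin n → ℝ) × ℝ => (∀ i, IsInvPow 2 (q.1 i)) ∧ IsInvPow 2 q.2 ∧
      G (Fin.cons q.2 q.1) 1 ∧ ∀ t, IsInvPow 2 t → q.2 < t → ¬ G (Fin.cons t q.1) 1) := by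
    refine (Dfn.forall_finite fun i => hinv.comp (by fun_prop)).and ((hinv.comp (by fun_prop)).and
      ((hGd.comp₂ (DFun.finCons (by fun_prop) (by fun_prop)) h1).and (Dfn.all
      ((hinv.comp (by fun_prop)).imp ((Dfn.lt (by fun_prop) (by fun_prop)).imp
      (hGd.comp₂ (DFun.finCons (by fun_prop) (by fun_prop)) h1).not)))))
  have hG1 : ∀ v a, G (Fin.cons (1 / (2 : ℝ) ^ a) (encVec v)) 1 ↔ f (a ::ᵥ v) = 0 := fun v a => by
    rw [← encVec_cons, show (1 : ℝ) = 1 / 2 ^ 0 by simp, hG, codedRel_enc, eq_comm]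
  have hlt : ∀ m n : ℕ, 1 / (2 : ℝ) ^ m < 1 / (2 : ℝ) ^ n ↔ n < m := fun m n => by
    exact_mod_cast one_div_pow_lt_iff (b := 2) le_rfl
  refine hD.of_iff fun q => ?_
  obtain ⟨x, y⟩ := q
  constructor
  · rintro ⟨v, a, ⟨h0, hk⟩, rfl, rfl⟩
    refine ⟨isInvPow_encVec v, ⟨a, by simp⟩, (hG1 v a).2 h0, ?_⟩
    rintro _ ⟨k, rfl⟩ hlt' hGk
    push_cast at hlt' hGk
    exact hk k ((hlt _ _).1 hlt') ((hG1 v k).1 hGk)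
  · rintro ⟨hx, ⟨a, rfl⟩, h0, hk⟩
    obtain ⟨v, rfl⟩ := exists_encVec hx
    push_cast at h0 hk ⊢
    refine ⟨v, a, ⟨(hG1 v a).1 h0, fun k hka hk0 => ?_⟩, rfl, rfl⟩
    exact hk _ ⟨k, by simp⟩ ((hlt _ _).2 hka) ((hG1 v k).2 hk0)

/-- Primitive recursion: the graph is definable with parameters, and the recursion equations
single it out. -/
theorem NatDfn.prec [OrderAddDefinable L] (hcomp : ∀ (n : ℕ) (X : Set (Fin n → ℝ)), IsCompact X →
    Dfn L Set.univ (fun x : Fin n → ℝ => x ∈ X)) (hone : Dfn L ∅ (fun x : ℝ => x = 1))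
    (hinv : Dfn L ∅ (IsInvPow 2)) {n : ℕ} {f : List.Vector ℕ n → ℕ}
    {g : List.Vector ℕ (n + 2) → ℕ} (hf : NatDfn L fun v a => a = f v)
    (hg : NatDfn L fun v a => a = g v) :
    NatDfn L (fun (v : List.Vector ℕ (n + 1)) a =>
      a = v.head.rec (f v.tail) fun y IH => g (y ::ᵥ IH ::ᵥ v.tail)) := by
  set h : ℕ → List.Vector ℕ n → ℕ := fun a v => Nat.rec (f v) (fun y IH => g (y ::ᵥ IH ::ᵥ v)) a
    with hh
  have h1 : ∀ {Γ : Type} [RealCtx Γ], DFun L ∅ (fun _ : Γ => (1 : ℝ)) := hone.snd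
  set F := CodedRel fun v a => a = f v with hF
  set G := CodedRel fun v a => a = g v with hG
  have hFd : Dfn L ∅ (fun q : (Fin n → ℝ) × ℝ => F q.1 q.2) := hf
  have hGd : Dfn L ∅ (fun q : (Fin (n + 2) → ℝ) × ℝ => G q.1 q.2) := hg
  have hpar : Dfn L Set.univ (fun q : (Fin (n + 1) → ℝ) × ℝ =>
      (Fin.cons q.2 q.1 : Fin (n + 2) → ℝ) ∈
        encVec '' {w : List.Vector ℕ (n + 2) | w.head = h w.tail.head w.tail.tail}) :=
    (dfn_encVec hcomp _).comp (DFun.finCons (by fun_prop) (by fun_prop))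
  have hpar' : ∀ (a : ℕ) (v : List.Vector ℕ n) (y : ℝ),
      (Fin.cons y (Fin.cons (1 / (2 : ℝ) ^ a) (encVec v)) : Fin (n + 2) → ℝ) ∈
        encVec '' {w : List.Vector ℕ (n + 2) | w.head = h w.tail.head w.tail.tail} ↔
      y = 1 / (2 : ℝ) ^ h a v := fun a v y => by
    constructor
    · rintro ⟨w, hw, hwe⟩
      rw [← w.cons_head_tail, ← w.tail.cons_head_tail, encVec_cons, encVec_cons,
        Fin.cons_inj, Fin.cons_inj] at hwe
      obtain ⟨h2, h3, h4⟩ := hwe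
      rw [← h2, hw, enc_inj.1 h3, encVec_injective h4]
    · rintro rfl
      exact ⟨h a v ::ᵥ a ::ᵥ v, by simp, by rw [encVec_cons, encVec_cons]⟩
  obtain ⟨k, Q, c, hQ, hc⟩ := hpar.exists_param
  have hQ' : Dfn L ∅ (fun q : (Fin (n + 1) → ℝ) × ℝ × (Fin k → ℝ) => Q (q.1, q.2.1) q.2.2) :=
    hQ.comp (f := fun q : (Fin (n + 1) → ℝ) × ℝ × (Fin k → ℝ) => ((q.1, q.2.1), q.2.2))
      (by fun_prop)
  -- `Ax c` states the recursion equations for the relation that c defines: argument 0 is coded by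
  -- 1, and the predecessor of the argument coded by t is coded by t + t.
  obtain ⟨Ax, hAxD, hAx⟩ : ∃ Ax : (Fin k → ℝ) → Prop, Dfn L ∅ Ax ∧ ∀ c, Ax c ↔
      ∀ (x : Fin n → ℝ), (∀ i, IsInvPow 2 (x i)) →
        (∀ y, Q (Fin.cons 1 x, y) c ↔ F x y) ∧ ∀ t, IsInvPow 2 (t + t) → ∀ y,
          (Q (Fin.cons t x, y) c ↔ ∃ z, Q (Fin.cons (t + t) x, z) c ∧
            G (Fin.cons (t + t) (Fin.cons z x)) y) := by
    refine ⟨_, ?_, fun c => Iff.rfl⟩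
    refine Dfn.all (Dfn.imp (Dfn.forall_finite fun i => hinv.comp (by fun_prop)) (Dfn.and
      (Dfn.all (Dfn.iff ?_ (hFd.comp₂ (by fun_prop) (by fun_prop)))) (Dfn.all (Dfn.imp
      (hinv.comp (by fun_prop)) (Dfn.all (Dfn.iff ?_ (Dfn.ex (Dfn.and ?_ ?_))))))))
    · exact hQ'.comp₃ (R := fun a b c => Q (a, b) c) (DFun.finCons h1 (by fun_prop)) (by fun_prop)
        (by fun_prop)
    · exact hQ'.comp₃ (R := fun a b c => Q (a, b) c) (DFun.finCons (by fun_prop) (by fun_prop))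
        (by fun_prop) (by fun_prop)
    · exact hQ'.comp₃ (R := fun a b c => Q (a, b) c) (DFun.finCons (by fun_prop) (by fun_prop))
        (by fun_prop) (by fun_prop)
    · exact hGd.comp₂ (DFun.finCons (by fun_prop) (DFun.finCons (by fun_prop) (by fun_prop)))
        (by fun_prop)
  have hD := Dfn.and (Dfn.forall_finite (ι := Fin (n + 1))
    (P := fun i (q : (Fin (n + 1) → ℝ) × ℝ) => IsInvPow 2 (q.1 i))
    fun i => hinv.comp (by fun_prop)) (Dfn.ex (P := fun q c => Ax c ∧ Q q c) (hAxD.snd.and hQ))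
  have hhalf : ∀ a : ℕ, 1 / (2 : ℝ) ^ (a + 1) + 1 / (2 : ℝ) ^ (a + 1) = 1 / (2 : ℝ) ^ a :=
    fun a => by rw [pow_succ]; field_simp; norm_num
  have hF1 : ∀ v y, F (encVec v) y ↔ y = 1 / (2 : ℝ) ^ f v := fun v y => by
    constructor
    · intro hy
      obtain ⟨m, rfl, hm⟩ := hy.exists_eq
      exact hm
    · rintro rfl
      exact codedRel_enc.2 rfl
  have hG1 : ∀ v a b y, G (Fin.cons (1 / (2 : ℝ) ^ a) (Fin.cons (1 / (2 : ℝ) ^ b) (encVec v))) y ↔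
      y = 1 / (2 : ℝ) ^ g (a ::ᵥ b ::ᵥ v) := fun v a b y => by
    rw [← encVec_cons, ← encVec_cons]
    constructor
    · intro hy
      obtain ⟨m, rfl, hm⟩ := hy.exists_eq
      exact hm
    · rintro rfl
      exact codedRel_enc.2 rfl
  refine hD.of_iff fun q => ?_
  obtain ⟨x, y⟩ := q
  constructor
  · rintro ⟨w, a, rfl, rfl, rfl⟩
    refine ⟨isInvPow_encVec w, c, (hAx c).2 fun x hx => ?_, ?_⟩
    · obtain ⟨v, rfl⟩ := exists_encVec hx
      constructor
      · intro y
        rw [← hc, show (1 : ℝ) = 1 / 2 ^ 0 by simp, hpar', hF1]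
        rfl
      · rintro t ⟨b, hb⟩ y
        push_cast at hb
        obtain rfl : t = 1 / (2 : ℝ) ^ (b + 1) := by have := hhalf b; linarith
        rw [← hc, hpar', hhalf]
        simp only [← hc, hpar', exists_eq_left, hG1]
        rfl
    · rw [← hc, ← w.cons_head_tail, encVec_cons, hpar']
      simp [hh]
  · rintro ⟨hx, c', hax, hq⟩
    rw [hAx] at hax
    obtain ⟨w, rfl⟩ := exists_encVec hx
    refine ⟨w, _, rfl, rfl, ?_⟩
    -- Any parameter satisfying the axioms defines the same function on codes, by induction on the
    -- recursion argument; so it does not matter which c' the quantifier supplies.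
    have key : ∀ (a : ℕ) (v : List.Vector ℕ n) (y : ℝ),
        Q (Fin.cons (1 / (2 : ℝ) ^ a) (encVec v), y) c' ↔ y = 1 / (2 : ℝ) ^ h a v := by
      intro a v
      obtain ⟨hax0, hax1⟩ := hax (encVec v) (isInvPow_encVec v)
      induction a with
      | zero =>
        intro y
        rw [pow_zero, div_one, hax0, hF1]
        rfl
      | succ a ih =>
        intro y
        rw [hax1 _ ⟨a, by rw [hhalf]; simp⟩, hhalf]
        simp only [ih, exists_eq_left, hG1]
        rfl
    have := (key w.head w.tail y)
    rw [← encVec_cons, w.cons_head_tail] at this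
    exact this.1 hq

theorem NatDfn.of_primrec [OrderAddDefinable L] (hcomp : ∀ (n : ℕ) (X : Set (Fin n → ℝ)), IsCompact X →
    Dfn L Set.univ (fun x : Fin n → ℝ => x ∈ X)) (hone : Dfn L ∅ (fun x : ℝ => x = 1))
    (hinv : Dfn L ∅ (IsInvPow 2)) {n : ℕ} {f : List.Vector ℕ n → ℕ} (hf : Nat.Primrec' f) :
    NatDfn L fun v a => a = f v := by
  have h1 : ∀ {Γ : Type} [RealCtx Γ], DFun L ∅ (fun _ : Γ => (1 : ℝ)) := hone.snd
  have hhalf : ∀ a : ℕ, 1 / (2 : ℝ) ^ (a + 1) + 1 / (2 : ℝ) ^ (a + 1) = 1 / (2 : ℝ) ^ a :=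
    fun a => by rw [pow_succ]; field_simp; norm_num
  induction hf with
  | zero =>
    have hD : Dfn L ∅ (fun q : (Fin 0 → ℝ) × ℝ => q.2 = 1) := Dfn.eq (by fun_prop) h1
    refine hD.of_iff fun q => ?_
    constructor
    · rintro ⟨v, m, rfl, -, hm⟩
      simpa using hm
    · intro hq
      exact ⟨List.Vector.nil, 0, rfl, Subsingleton.elim _ _, by simpa using hq⟩
  | succ =>
    have hD : Dfn L ∅ (fun q : (Fin 1 → ℝ) × ℝ => IsInvPow 2 (q.1 0) ∧ q.2 + q.2 = q.1 0) :=
      (hinv.comp (by fun_prop)).and (Dfn.eq (by fun_prop) (by fun_prop))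
    refine hD.of_iff fun q => ?_
    obtain ⟨x, y⟩ := q
    constructor
    · rintro ⟨v, m, rfl, rfl, rfl⟩
      refine ⟨isInvPow_encVec v 0, ?_⟩
      rw [hhalf]
      simp [encVec]
    · rintro ⟨hx, hy⟩
      obtain ⟨v, rfl⟩ := exists_encVec (x := x) fun i => by rwa [Subsingleton.elim i 0]
      refine ⟨v, _, rfl, rfl, ?_⟩
      have := hhalf v.head
      simp only [encVec, List.Vector.get_zero] at hy
      change y = 1 / 2 ^ (v.head + 1)
      linarith
  | @get n i =>
    have hD : Dfn L ∅ (fun q : (Fin n → ℝ) × ℝ => (∀ i, IsInvPow 2 (q.1 i)) ∧ q.2 = q.1 i) :=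
      (Dfn.forall_finite fun i => hinv.comp (by fun_prop)).and (Dfn.eq (by fun_prop) (by fun_prop))
    refine hD.of_iff fun q => ?_
    obtain ⟨x, y⟩ := q
    constructor
    · rintro ⟨v, m, rfl, rfl, rfl⟩
      exact ⟨isInvPow_encVec v, rfl⟩
    · rintro ⟨hx, hy⟩
      obtain ⟨v, rfl⟩ := exists_encVec hx
      exact ⟨v, _, rfl, rfl, hy⟩
  | @comp m n f g _ _ ihf ihg =>
    refine (NatDfn.comp hinv ihf ihg).congr fun v a => ?_
    constructor
    · rintro rfl
      exact ⟨_, fun i => List.Vector.get_ofFn _ _, rfl⟩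
    · rintro ⟨w, hw, rfl⟩
      congr 1
      exact List.Vector.ext fun i => by rw [hw, List.Vector.get_ofFn]
  | prec _ _ ihf ihg => exact NatDfn.prec hcomp hone hinv ihf ihg

theorem NatDfn.of_partrec [OrderAddDefinable L] (hcomp : ∀ (n : ℕ) (X : Set (Fin n → ℝ)), IsCompact X →
    Dfn L Set.univ (fun x : Fin n → ℝ => x ∈ X)) (hone : Dfn L ∅ (fun x : ℝ => x = 1))
    (hinv : Dfn L ∅ (IsInvPow 2)) {n : ℕ} {f : List.Vector ℕ n →. ℕ} (hf : Nat.Partrec' f) :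
    NatDfn L fun v a => a ∈ f v := by
  induction hf with
  | prim hf => exact (NatDfn.of_primrec hcomp hone hinv hf).congr fun v a => by simp
  | comp g _ _ ihf ihg =>
    refine (NatDfn.comp hinv ihf ihg).congr fun v a => ?_
    refine Part.mem_bind_iff.trans ?_
    simp only [mem_mOfFn_iff]
  | @rfind n f _ ihf =>
    refine (NatDfn.rfind (f := f) hinv hone (ihf.congr fun v a => by simp)).congr fun v a => ?_
    refine Nat.mem_rfind.trans ?_
    simp [eq_comm]

end

/-! ### Reduction of the halting problem -/

section

open Nat.Partrec (Code)

theorem partrec'_eval_zero :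
    Nat.Partrec' fun v : List.Vector ℕ 1 => Code.eval (Denumerable.ofNat Code v.head) 0 :=
  Nat.Partrec'.part_iff₁.2
    (Nat.Partrec.Code.eval_part.comp (Computable.ofNat Code) (Computable.const 0))

/-- The term `2 ^ n * x₀`. -/
def doublingTerm : ℕ → cantorLanguage.Term (Empty ⊕ Fin 2)
  | 0 => .var (Sum.inr 0)
  | n + 1 => .func CantorFunc.add ![doublingTerm n, doublingTerm n]

/-- The sentence `∀ x₀ x₁, 2 ^ n * x₀ = x₁ → ψ`. -/
def doublingSentence (ψ : cantorLanguage.BoundedFormula Empty 2) (n : ℕ) :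
    cantorLanguage.Sentence :=
  .all (.all (.imp (.equal (doublingTerm n) (.var (Sum.inr 1))) ψ))

/-- The term doubles in size at each step, but its Gödel number is obtained from the previous one by
two pairings. -/
theorem primrec_termCode_doublingTerm : Primrec fun n => termCode (doublingTerm n) := by
  have h : Primrec fun n : ℕ => (Nat.rec (Nat.pair 0 0)
      (fun _ c => Nat.pair 1 (Nat.pair c c)) n : ℕ) := by
    refine Primrec.nat_rec₁ _ ?_
    exact Primrec₂.natPair.comp (Primrec.const 1)
      (Primrec₂.natPair.comp Primrec.snd Primrec.snd)
  refine h.of_eq fun n => ?_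
  induction n with
  | zero => rfl
  | succ n ih => simpa [doublingTerm, termCode] using ih

theorem primrec_formulaCode_doublingSentence (ψ : cantorLanguage.BoundedFormula Empty 2) :
    Primrec fun n => formulaCode (doublingSentence ψ n) := by
  have h : Primrec fun n => Nat.pair 6 (Nat.pair 6 (Nat.pair 5 (Nat.pair
      (Nat.pair 1 (Nat.pair (termCode (doublingTerm n)) (Nat.pair 0 1))) (formulaCode ψ)))) :=
    Primrec₂.natPair.comp (.const _) (Primrec₂.natPair.comp (.const _) (Primrec₂.natPair.comp
      (.const _) (Primrec₂.natPair.comp (Primrec₂.natPair.comp (.const _)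
      (Primrec₂.natPair.comp primrec_termCode_doublingTerm (.const _))) (.const _))))
  exact h.of_eq fun n => rfl

theorem realize_doublingTerm (P Q : Set ℝ) (v : Empty ⊕ Fin 2 → ℝ) (n : ℕ) :
    letI := realExpansion P Q
    (doublingTerm n).realize v = 2 ^ n * v (Sum.inr 0) := by
  let := realExpansion P Q
  induction n with
  | zero => simp [doublingTerm]
  | succ n ih =>
    change (doublingTerm n).realize v + (doublingTerm n).realize v = _
    rw [ih]
    ring

/-- A set definable without parameters whose trace on the powers of `1 / 2` is not computable makes
the theory undecidable. -/
theorem not_hasDecidableTheory_of_dfn {P Q : Set ℝ} {H : ℕ → Prop} (hH : ¬ ComputablePred H)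
    (hD : letI := realExpansion P Q; Dfn cantorLanguage ∅ fun v : Fin 2 → ℝ =>
      v 1 = 1 → ∃ n, v 0 = 1 / 2 ^ n ∧ H n) :
    ¬ HasDecidableTheory (realExpansion P Q) := by
  let := realExpansion P Q
  obtain ⟨φ, hφ⟩ := Set.empty_definable_iff.1 hD
  have hφ' : ∀ v : Fin 2 → ℝ, (v 1 = 1 → ∃ n, v 0 = 1 / 2 ^ n ∧ H n) ↔ φ.Realize v :=
    fun v => Set.ext_iff.1 hφ v
  rintro ⟨f, hf, hfφ⟩
  let ψ : cantorLanguage.BoundedFormula Empty 2 :=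
    Language.BoundedFormula.relabel (k := 0) (n := 2) (Sum.inr : Fin 2 → Empty ⊕ Fin 2) φ
  refine hH (ComputablePred.computable_iff.2
    ⟨fun n => f (formulaCode (doublingSentence ψ n)),
      hf.comp (primrec_formulaCode_doublingSentence ψ).to_comp, funext fun n => propext ?_⟩)
  have hψ : ∀ (u : Empty → ℝ) (v : Fin 2 → ℝ), ψ.Realize u v ↔ φ.Realize v := fun u v => by
    rw [Language.BoundedFormula.realize_relabel]
    exact iff_of_eq (congrArg₂ _ rfl (Subsingleton.elim _ _))
  -- The language has no constant 1, so the condition y = 1 sits inside ψ; together with 2^n x = y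
  -- it pins x to 2^(-n).
  have hS : doublingSentence ψ n ∈ cantorLanguage.completeTheory ℝ ↔
      ∀ x y : ℝ, 2 ^ n * x = y → (y = 1 → ∃ n, x = 1 / 2 ^ n ∧ H n) := by
    rw [FirstOrder.Language.mem_completeTheory]
    simp only [doublingSentence, Language.Sentence.Realize, Language.Formula.Realize,
      Language.BoundedFormula.realize_all, Language.BoundedFormula.realize_imp]
    refine forall_congr' fun x => forall_congr' fun y => imp_congr ?_ ((hψ _ _).trans (hφ' _).symm)
    exact iff_of_eq (congrArg (· = y) (realize_doublingTerm P Q _ n))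
  rw [hfφ, hS]
  constructor
  · rintro hn x _ rfl h1
    exact ⟨n, by rw [eq_div_iff (by positivity), mul_comm, h1], hn⟩
  · intro h
    obtain ⟨m, hm, hmH⟩ := h (1 / 2 ^ n) 1 (by field_simp) rfl
    rwa [enc_inj.1 hm]

theorem not_hasDecidableTheory_of_firstRun {r k b : ℕ} {K : Set ℕ} {Q : Set ℝ}
    (h : FirstRun r K k b)
    (hcomp : DefinesEveryCompactSet (realExpansion (genCantorSet r K) Q)) :
    ¬ HasDecidableTheory (realExpansion (genCantorSet r K) Q) := by
  let := realExpansion (genCantorSet r K) Q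
  have := orderAddDefinable_realExpansion (genCantorSet r K) Q
  have hcomp' : ∀ (n : ℕ) (X : Set (Fin n → ℝ)), IsCompact X →
      Dfn cantorLanguage Set.univ (fun x : Fin n → ℝ => x ∈ X) := hcomp
  have hC := dfn_realExpansion_fst (genCantorSet r K) Q
  -- The number 1 is the maximum of the Cantor set.
  have hone : Dfn cantorLanguage ∅ (fun x : ℝ => x = 1) := by
    have hD : Dfn cantorLanguage ∅ (fun x : ℝ => x ∈ genCantorSet r K ∧
        ∀ y, y ∈ genCantorSet r K → y ≤ x) :=
      hC.and (Dfn.all (hC.snd.imp (Dfn.le (by fun_prop) (by fun_prop))))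
    refine hD.of_iff fun x => ⟨?_, fun hx => le_antisymm hx.1.1.2 (hx.2 1 h.one_mem)⟩
    rintro rfl
    exact ⟨h.one_mem, fun y hy => hy.1.2⟩
  have h1 : ∀ {Γ : Type} [RealCtx Γ], DFun cantorLanguage ∅ (fun _ : Γ => (1 : ℝ)) := hone.snd
  have hinv : Dfn cantorLanguage ∅ (IsInvPow 2) := by
    refine dfn_isInvPow_two hone (((dfn_encVec hcomp' (n := 1) Set.univ).comp
      (f := fun x : ℝ => fun _ => x) (by fun_prop)).of_iff fun x => ?_)
    constructor
    · intro hx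
      obtain ⟨v, hv⟩ := exists_encVec (x := fun _ : Fin 1 => x) fun _ => hx
      exact ⟨v, trivial, hv.symm⟩
    · rintro ⟨v, -, hv⟩
      rw [← congrFun hv 0]
      exact isInvPow_encVec v 0
  have hev := NatDfn.of_partrec hcomp' hone hinv partrec'_eval_zero
  refine not_hasDecidableTheory_of_dfn
    (H := fun n => (Code.eval (Denumerable.ofNat Code n) 0).Dom) (fun hH => ?_) ?_
  · obtain ⟨f, hf, hfH⟩ := ComputablePred.computable_iff.1 hH
    refine ComputablePred.halting_problem 0 (ComputablePred.computable_iff.2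
      ⟨fun c => f (Encodable.encode c), hf.comp Computable.encode, funext fun c => ?_⟩)
    simpa using congrFun hfH (Encodable.encode c)
  · have hD : Dfn cantorLanguage ∅ (fun v : Fin 2 → ℝ => v 1 = 1 → ∃ y,
        CodedRel (fun (v : List.Vector ℕ 1) a => a ∈ Code.eval (Denumerable.ofNat Code v.head) 0)
          (fun _ => v 0) y) :=
      (Dfn.eq (by fun_prop) h1).imp (Dfn.ex (Dfn.comp₂ hev (by fun_prop) (by fun_prop)))
    refine hD.of_iff fun v => imp_congr_right fun _ => ?_
    constructor
    · rintro ⟨n, hn, hdom⟩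
      refine ⟨_, n ::ᵥ .nil, _, Part.get_mem hdom, funext fun i => ?_, rfl⟩
      rw [hn, encVec, Subsingleton.elim i 0]
      rfl
    · rintro ⟨y, w, m, hm, hw, -⟩
      exact ⟨w.head, by simpa [encVec] using congrFun hw 0, Part.dom_iff_mem.2 ⟨m, hm⟩⟩

end

theorem theoremB (r s : ℕ) (hr : 3 ≤ r) (hs : 3 ≤ s) (hrs : Irrational (Real.logb r s))
    (K L : Set ℕ) (hK : K.Nonempty) (hKr : K ⊆ Set.Icc 1 (r - 2))
    (hL : L.Nonempty) (hLs : L ⊆ Set.Icc 1 (s - 2)) :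
    DefinesEveryCompactSet (realExpansion (genCantorSet r K) (genCantorSet s L)) ∧
      ¬ HasDecidableTheory (realExpansion (genCantorSet r K) (genCantorSet s L)) := by
  obtain ⟨k, b, h⟩ := exists_firstRun hr hK hKr
  obtain ⟨k', b', h'⟩ := exists_firstRun hs hL hLs
  have hcomp := definesEveryCompactSet_of_firstRun h h' hrs
  exact ⟨hcomp, not_hasDecidableTheory_of_firstRun h hcomp⟩
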